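/- A \emph{polytope} is the convex hull of a finite set of points in some $\mathbb R^d$; a \emph{face} of a polytope $P$ is a nonempty set $\{x\in P\mid \ell(x)=c\}$, where $\ell$ is a linear form with $\ell\ge c$ on $P$. A homeomorphism $P\to Q$ of polytopes is \emph{polyhedral} if it maps every face of $P$ onto a face of $Q$. A \emph{polyhedral CW complex} is a Hausdorff space $K$ with a family of continuous maps $\{\alpha:P_\alpha\to K\}_{\alpha\in I}$, each $P_\alpha$ a nonempty polytope with relative interior $P_\alpha^\circ$, such that: each $\alpha|_{P_\alpha^\circ}$ is a homeomorphism onto its image; $K$ is the disjoint union of the sets $\alpha(P_\alpha^\circ)$, $\alpha\in I$; a set $A\subseteq K$ is closed if and only if $A\cap\alpha(P_\alpha)$ is closed for every $\alpha\in I$; and for every $\alpha\in I$ and every face $F$ of $P_\alpha$ there are $\beta\in I$ and a polyhedral homeomorphism $\phi^F:P_\beta\to F$ with $\beta=\alpha\circ\phi^F$. Its \emph{face category} $\mathscr F(K)$ has object set $I$; the morphisms $\beta\to\alpha$ are all such maps $\phi^F:P_\beta\to F\subseteq P_\alpha$ with $F$ a face of $P_\alpha$, and composition is composition of maps (so $\phi^G\circ\phi^F=\phi^{\phi^G(F)}$).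 The \emph{geometric realization} $\|\mathscr C\|$ of a small acyclic category $\mathscr C$ (one whose only endomorphisms are identities and whose only invertible morphisms are identities) is the quotient space of the disjoint union of standard simplices $\Delta[\gamma]$, one $d$-simplex for each chain $\gamma$ of $d\ge 0$ composable non-identity morphisms (for $d=0$: for each object), with vertices indexed by the $d+1$ objects of $\gamma$, in which, for every $\gamma$ with $d\ge 1$ and $0\le i\le d$, the simplex of the chain obtained from $\gamma$ by omitting its $i$-th object is identified with the $i$-th face of $\Delta[\gamma]$. \textbf{Proposition.} Let $K$ be a polyhedral CW complex. Then there is a homeomorphism $\|\mathscr F(K)\|\cong K$. -/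

import Mathlib

open CategoryTheory

universe u v

/-! ### Polytopes, faces, polyhedral homeomorphisms -/

/-- A polytope: the convex hull of a finite set of points. -/
def IsPolytope {E : Type*} [AddCommGroup E] [Module ℝ E] (P : Set E) : Prop :=
  ∃ S : Set E, S.Finite ∧ P = convexHull ℝ S

/-- A face of `P`: a nonempty set `{x ∈ P | ℓ x = c}`, where `ℓ` is a linear form with
`ℓ ≥ c` on `P`. -/
def IsFace {E : Type*} [AddCommGroup E] [Module ℝ E] (P F : Set E) : Prop :=
  F.Nonempty ∧ ∃ (l : E →ₗ[ℝ] ℝ) (c : ℝ), (∀ x ∈ P, c ≤ l x) ∧ F = {x ∈ P | l x = c}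

/-- A homeomorphism `f : P → Q` is polyhedral if the image of every face of `P` is a face
of `Q`. -/
def IsPolyhedral {E E' : Type*} [AddCommGroup E] [Module ℝ E] [TopologicalSpace E]
    [AddCommGroup E'] [Module ℝ E'] [TopologicalSpace E'] {P : Set E} {Q : Set E'}
    (f : P ≃ₜ Q) : Prop :=
  ∀ F : Set E, IsFace P F → IsFace Q ((fun x : P => (f x : E')) '' {x : P | (x : E) ∈ F})

section Faces

variable {E : Type*} [AddCommGroup E] [Module ℝ E] {P F G : Set E}

theorem IsFace.subset (h : IsFace P F) : F ⊆ P := by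
  obtain ⟨-, l, c, -, rfl⟩ := h
  exact fun x hx => hx.1

theorem IsFace.refl (h : P.Nonempty) : IsFace P P :=
  ⟨h, 0, 0, by simp, by simp⟩

/-- A face of `P` that lies in `F ⊆ P` is a face of `F`. -/
theorem IsFace.of_subset (hG : IsFace P G) (hGF : G ⊆ F) (hFP : F ⊆ P) : IsFace F G := by
  obtain ⟨hne, l, c, hl, hG⟩ := hG
  refine ⟨hne, l, c, fun x hx => hl x (hFP hx), ?_⟩
  ext x
  constructor
  · intro hx
    refine ⟨hGF hx, ?_⟩
    rw [hG] at hx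
    exact hx.2
  · rintro ⟨h1, h2⟩
    rw [hG]
    exact ⟨hFP h1, h2⟩

/-- A linear form that is at least `c` on `S` and takes the value `c` at a point of the convex
hull of `S` takes it at a point which is a convex combination of points of `S` where it
equals `c`. -/
theorem mem_convexHull_level {S : Set E} {l : E →ₗ[ℝ] ℝ} {c : ℝ} (hl : ∀ s ∈ S, c ≤ l s)
    {x : E} (hx : x ∈ convexHull ℝ S) (hxc : l x = c) :
    x ∈ convexHull ℝ {s ∈ S | l s = c} := by
  rw [convexHull_eq] at hx
  obtain ⟨ι, t, w, z, hw0, hw1, hz, rfl⟩ := hx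
  have hsum : ∑ i ∈ t, w i * (l (z i) - c) = 0 := by
    have h1 : l (t.centerMass w z) = ∑ i ∈ t, w i * l (z i) := by
      rw [Finset.centerMass_eq_of_sum_1 _ _ hw1, map_sum]
      simp
    simp only [mul_sub, Finset.sum_sub_distrib, ← Finset.sum_mul, hw1, one_mul]
    rw [← h1, hxc, sub_self]
  have hz0 := (Finset.sum_eq_zero_iff_of_nonneg
    (fun i hi => mul_nonneg (hw0 i hi) (sub_nonneg.2 (hl _ (hz i hi))))).1 hsum
  classical
  rw [← Finset.centerMass_filter_ne_zero]
  refine Finset.centerMass_mem_convexHull _ (fun i hi => hw0 i (Finset.mem_filter.1 hi).1) ?_ ?_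
  · rw [Finset.sum_filter_ne_zero, hw1]
    exact one_pos
  · intro i hi
    obtain ⟨hi, hne⟩ := Finset.mem_filter.1 hi
    refine ⟨hz i hi, ?_⟩
    have := (mul_eq_zero.1 (hz0 i hi)).resolve_left hne
    linarith

/-- A face of a face of a polytope is a face of the polytope. -/
theorem IsFace.trans (hP : IsPolytope P) (hF : IsFace P F) (hG : IsFace F G) : IsFace P G := by
  obtain ⟨S, hS, rfl⟩ := hP
  obtain ⟨-, l, c, hl, rfl⟩ := hF
  obtain ⟨hne, m, d, hm, rfl⟩ := hG
  have hSP : S ⊆ convexHull ℝ S := subset_convexHull ℝ S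
  -- a large multiple of `l - c` dominates `d - m` on the finite set `S`
  have hN : ∃ N : ℝ, ∀ s ∈ S, l s ≠ c → d - m s < N * (l s - c) := by
    obtain ⟨N, hN⟩ := (hS.image fun s => (d - m s) / (l s - c)).bddAbove
    refine ⟨N + 1, fun s hs hsc => ?_⟩
    have hpos : 0 < l s - c := sub_pos.2 (lt_of_le_of_ne (hl s (hSP hs)) (Ne.symm hsc))
    have h1 : (d - m s) / (l s - c) ≤ N := hN ⟨s, hs, rfl⟩
    rw [div_le_iff₀ hpos] at h1
    nlinarith
  obtain ⟨N, hN⟩ := hN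
  have hval : ∀ x, (N • l + m) x = N * l x + m x := fun x => by simp
  have hSge : ∀ s ∈ S, N * c + d ≤ (N • l + m) s := by
    intro s hs
    rw [hval]
    by_cases hsc : l s = c
    · have := hm s ⟨hSP hs, hsc⟩
      rw [hsc]
      linarith
    · have := hN s hs hsc
      linarith
  have hge : ∀ x ∈ convexHull ℝ S, N * c + d ≤ (N • l + m) x := by
    have hconv : Convex ℝ {x | N * c + d ≤ (N • l + m) x} :=
      convex_halfSpace_ge (LinearMap.isLinear _) _
    exact fun x hx => convexHull_min hSge hconv hx
  refine ⟨hne, N • l + m, N * c + d, hge, ?_⟩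
  ext x
  constructor
  · rintro ⟨⟨hx, hxc⟩, hxd⟩
    exact ⟨hx, by rw [hval, hxc, hxd]⟩
  · rintro ⟨hx, hxv⟩
    have h1 := mem_convexHull_level hSge hx hxv
    have h2 : {s ∈ S | (N • l + m) s = N * c + d} ⊆ {y | l y = c} := by
      rintro s ⟨hs, hsv⟩
      by_contra hsc
      have := hN s hs hsc
      rw [hval] at hsv
      linarith
    have h3 : l x = c := convexHull_min h2 (convex_hyperplane l.isLinear c) h1
    refine ⟨⟨hx, h3⟩, ?_⟩
    rw [hval, h3] at hxv
    linarith

end Faces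

/-! ### Polyhedral CW complexes -/

/-- The structure of a polyhedral CW complex on a (Hausdorff) space `K`: a family of continuous
maps `map α : P α → K` from nonempty polytopes, where `P α ⊆ ℝ ^ (dim α)`. The interior of a
polytope is its relative interior. -/
structure PolyhedralCWComplex (K : Type u) [TopologicalSpace K] where
  /-- the index set of the cells -/
  ι : Type v
  /-- the dimension of the Euclidean space that contains the polytope `P α` -/
  dim : ι → ℕ
  P : ∀ α, Set (EuclideanSpace ℝ (Fin (dim α)))
  isPolytope : ∀ α, IsPolytope (P α)
  nonempty : ∀ α, (P α).Nonempty
  map : ∀ α, P α → K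
  continuous_map : ∀ α, Continuous (map α)
  /-- the restriction of `map α` to the interior is a homeomorphism onto its image -/
  isEmbedding : ∀ α, Topology.IsEmbedding
    (fun x : {x : P α // (x : EuclideanSpace ℝ (Fin (dim α))) ∈ intrinsicInterior ℝ (P α)} =>
      map α x)
  /-- the open cells cover `K` ... -/
  cover : (⋃ α, map α '' {x : P α |
    (x : EuclideanSpace ℝ (Fin (dim α))) ∈ intrinsicInterior ℝ (P α)}) = Set.univ
  /-- ... and are pairwise disjoint -/
  disjoint : Pairwise fun α β => Disjoint
    (map α '' {x : P α | (x : EuclideanSpace ℝ (Fin (dim α))) ∈ intrinsicInterior ℝ (P α)})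
    (map β '' {x : P β | (x : EuclideanSpace ℝ (Fin (dim β))) ∈ intrinsicInterior ℝ (P β)})
  /-- weak topology -/
  isClosed_iff : ∀ A : Set K, IsClosed A ↔ ∀ α, IsClosed (A ∩ Set.range (map α))
  /-- every face of `P α` is parametrized, compatibly with the maps to `K`, by some `P β`
  through a polyhedral homeomorphism -/
  exists_face : ∀ α (F : Set (EuclideanSpace ℝ (Fin (dim α)))) (hF : IsFace (P α) F),
    ∃ (β : ι) (φ : P β ≃ₜ F), IsPolyhedral φ ∧
      ∀ x, map β x = map α (Set.inclusion hF.subset (φ x))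

namespace PolyhedralCWComplex

variable {K : Type*} [TopologicalSpace K] (X : PolyhedralCWComplex K)

/-- `φ : P β → P α` is a face map `φ^F` if it is (the corestriction to `P α` of) a polyhedral
homeomorphism from `P β` onto a face `F` of `P α` with `map β = map α ∘ φ`. -/
def IsFaceMap (β α : X.ι) (φ : X.P β → X.P α) : Prop :=
  ∃ (F : Set (EuclideanSpace ℝ (Fin (X.dim α)))) (hF : IsFace (X.P α) F) (e : X.P β ≃ₜ F),
    IsPolyhedral e ∧ (∀ x, φ x = Set.inclusion hF.subset (e x)) ∧
      ∀ x, X.map β x = X.map α (φ x)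

theorem IsFaceMap.id (α : X.ι) : X.IsFaceMap α α id := by
  refine ⟨X.P α, IsFace.refl (X.nonempty α), Homeomorph.refl _, ?_, fun x => rfl, fun x => rfl⟩
  intro F hF
  convert hF
  ext x
  constructor
  · rintro ⟨y, hy, rfl⟩
    exact hy
  · intro hx
    exact ⟨⟨x, hF.subset hx⟩, hx, rfl⟩

theorem IsFaceMap.comp {α β γ : X.ι} {φ : X.P α → X.P β} {ψ : X.P β → X.P γ}
    (hφ : X.IsFaceMap α β φ) (hψ : X.IsFaceMap β γ ψ) : X.IsFaceMap α γ (ψ ∘ φ) := by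
  obtain ⟨F, hF, e, he, hφe, hφm⟩ := hφ
  obtain ⟨G, hG, e', he', hψe, hψm⟩ := hψ
  have hψv : ∀ x, (ψ x : EuclideanSpace ℝ (Fin (X.dim γ))) = e' x := fun x => by
    rw [hψe]
  have hφv : ∀ x, (φ x : EuclideanSpace ℝ (Fin (X.dim β))) = e x := fun x => by
    rw [hφe]
  have hH := he' F hF
  set H := (fun x : X.P β => (e' x : EuclideanSpace ℝ (Fin (X.dim γ)))) ''
    {x : X.P β | (x : EuclideanSpace ℝ (Fin (X.dim β))) ∈ F} with hHdef
  -- the composite as an embedding with range `H`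
  have hemb : Topology.IsEmbedding
      (fun x : X.P α => (ψ (φ x) : EuclideanSpace ℝ (Fin (X.dim γ)))) := by
    have h1 : Topology.IsEmbedding φ := by
      have : φ = fun x => Set.inclusion hF.subset (e x) := funext hφe
      rw [this]
      exact (Topology.IsEmbedding.inclusion hF.subset).comp e.isEmbedding
    have h2 : Topology.IsEmbedding ψ := by
      have : ψ = fun x => Set.inclusion hG.subset (e' x) := funext hψe
      rw [this]
      exact (Topology.IsEmbedding.inclusion hG.subset).comp e'.isEmbedding
    exact Topology.IsEmbedding.subtypeVal.comp (h2.comp h1)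
  have hrange : Set.range (fun x : X.P α => (ψ (φ x) : EuclideanSpace ℝ (Fin (X.dim γ)))) = H := by
    ext y
    constructor
    · rintro ⟨x, rfl⟩
      refine ⟨φ x, ?_, (hψv _).symm⟩
      change (φ x : EuclideanSpace ℝ (Fin (X.dim β))) ∈ F
      rw [hφv]
      exact (e x).2
    · rintro ⟨x, hx, rfl⟩
      refine ⟨e.symm ⟨x, hx⟩, ?_⟩
      have : φ (e.symm ⟨x, hx⟩) = x := Subtype.ext (by rw [hφv]; simp)
      simp only [this, hψv]
  refine ⟨H, IsFace.trans (X.isPolytope γ) hG hH,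
    hemb.toHomeomorph.trans (Homeomorph.setCongr hrange), ?_, fun x => rfl, fun x => ?_⟩
  · intro J hJ
    have h1 := he' _ (IsFace.trans (X.isPolytope β) hF (he J hJ))
    have h2 : (fun x : X.P α => ((hemb.toHomeomorph.trans (Homeomorph.setCongr hrange)) x :
          EuclideanSpace ℝ (Fin (X.dim γ)))) '' {x | (x : EuclideanSpace ℝ _) ∈ J} =
        (fun x : X.P β => (e' x : EuclideanSpace ℝ (Fin (X.dim γ)))) ''
          {x : X.P β | (x : EuclideanSpace ℝ (Fin (X.dim β))) ∈
            (fun x : X.P α => (e x : EuclideanSpace ℝ (Fin (X.dim β)))) ''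
              {x | (x : EuclideanSpace ℝ _) ∈ J}} := by
      ext y
      constructor
      · rintro ⟨x, hx, rfl⟩
        exact ⟨φ x, ⟨x, hx, (hφv x).symm⟩, (hψv _).symm⟩
      · rintro ⟨z, ⟨x, hx, hxz⟩, rfl⟩
        refine ⟨x, hx, ?_⟩
        have : φ x = z := Subtype.ext (by rw [hφv]; exact hxz)
        change (ψ (φ x) : EuclideanSpace ℝ (Fin (X.dim γ))) = _
        rw [this, hψv]
    rw [h2]
    refine h1.of_subset ?_ hH.subset
    rintro y ⟨z, ⟨x, hx, hxz⟩, rfl⟩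
    refine ⟨z, ?_, rfl⟩
    change (z : EuclideanSpace ℝ (Fin (X.dim β))) ∈ F
    rw [← hxz]
    exact (e x).2
  · rw [hφm, hψm]; rfl

/-- The objects of the face category: the indices of the cells. -/
def FaceCategory : Type _ := X.ι

/-- The face category: the morphisms from `β` to `α` are the face maps `φ^F : P β → F ⊆ P α`,
and composition is composition of maps (the composite of `φ^F : P α → P β` and
`φ^G : P β → P γ` has image `φ^G(F)`). -/
instance : Category X.FaceCategory where
  Hom β α := {φ : X.P β → X.P α // X.IsFaceMap β α φ}
  id α := ⟨id, IsFaceMap.id X α⟩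
  comp φ ψ := ⟨ψ.1 ∘ φ.1, IsFaceMap.comp X φ.2 ψ.2⟩

end PolyhedralCWComplex

/-! ### Geometric realization of an acyclic category -/

/-- The morphism `f` is not an identity morphism. -/
def IsNonIdentity {C : Type*} [Category C] {x y : C} (f : x ⟶ y) : Prop :=
  ∀ h : x = y, f ≠ eqToHom h

/-- The set `Γ_d` of chains of `d` composable non-identity morphisms; for `d = 0`, of objects. -/
def NonIdentityChain (C : Type*) [Category C] (d : ℕ) : Type _ :=
  {γ : ComposableArrows C d // ∀ i : Fin d, IsNonIdentity (γ.map (homOfLE i.castSucc_le_succ))}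

/-- The disjoint union of the standard simplices `Δ[γ]`, with vertices indexed by the objects
of the chain `γ`. -/
abbrev SimplexSum (C : Type*) [Category C] : Type _ :=
  Σ γ : (Σ d, NonIdentityChain C d), stdSimplex ℝ (Fin (γ.1 + 1))

/-- The gluing relation: if `γ'` is the chain obtained from `γ` by omitting its `i`-th object
(dropping the first or the last morphism, or composing two consecutive ones), then a point of
`Δ[γ']` is identified with its image under the `i`-th face inclusion `Δ[γ'] → Δ[γ]`. -/
inductive FaceGluing (C : Type*) [Category C] : SimplexSum C → SimplexSum C → Prop
  | glue (d : ℕ) (γ : NonIdentityChain C (d + 1)) (γ' : NonIdentityChain C d) (i : Fin (d + 2))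
      (h : γ'.1 = γ.1.whiskerLeft (Fin.strictMono_succAbove i).monotone.functor)
      (x : stdSimplex ℝ (Fin (d + 1))) :
      FaceGluing C ⟨⟨d, γ'⟩, x⟩ ⟨⟨d + 1, γ⟩, stdSimplex.map i.succAbove x⟩

/-- The geometric realization of a small acyclic category (one whose only endomorphisms, and only
invertible morphisms, are the identities), with the quotient topology. -/
def GeometricRealization (C : Type*) [Category C] : Type _ := Quot (FaceGluing C)

instance (C : Type*) [Category C] : TopologicalSpace (GeometricRealization C) :=
  inferInstanceAs (TopologicalSpace (Quot (FaceGluing C)))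

/-! ### Faces, relative interiors and polar coordinates in convex sets -/

section ConvexGeometry

open Set

variable {E : Type*} [NormedAddCommGroup E] [NormedSpace ℝ E]

/-! The homeomorphism is barycentric subdivision. Choose a base point in the relative interior of
every polytope. A chain of non-identity face maps ending at `α` spans a simplex in `P α`, curved in
general: `eval` cones the simplex of the shorter chain, carried into the boundary of `P α` by the
last face map, from the base point of `P α`. Composing with the cell maps gives a map to `K` that
respects the gluing and is continuous.

Bijectivity rests on polar coordinates: a point of `P α` other than the base point lies on a unique
ray from it, which meets the relative boundary in exactly one point. A point of `P α` comes from a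
relatively interior point under exactly one face map (`IsFaceMap.ext_of_apply_eq`), so the polar
coordinates of a point with positive weights determine the last morphism, its weight and the
remaining point. Hence `evalPt_injective`, by induction on the chain. Every class in the realization
has a representative with positive weights, and open cells are disjoint, so the map is injective.
Coning over smaller cells covers each polytope by finitely many simplices (`exists_finite_cover`),
since it has finitely many faces; this gives surjectivity.

For the inverse, the weak topology reduces closedness of an image to single cells, where finitely
many compact simplices suffice. -/

theorem IsPolytope.convex {P : Set E} (hP : IsPolytope P) : Convex ℝ P := by
  obtain ⟨S, -, rfl⟩ := hP
  exact convex_convexHull ℝ S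

theorem IsPolytope.isCompact {P : Set E} (hP : IsPolytope P) : IsCompact P := by
  obtain ⟨S, hS, rfl⟩ := hP
  exact hS.isCompact_convexHull ℝ

/-- A convex combination attains the minimum of a linear form only if all generators with nonzero
weight do. Thus faces are again polytopes, and there are finitely many of them. -/
theorem isFace_convexHull_eq {S F : Set E} (hF : IsFace (convexHull ℝ S) F) :
    F = convexHull ℝ (S ∩ F) := by
  obtain ⟨-, l, c, hl, rfl⟩ := hF
  apply Subset.antisymm
  · rintro x ⟨hx, hxc⟩
    refine convexHull_mono ?_
      (mem_convexHull_level (fun s hs => hl s (subset_convexHull ℝ S hs)) hx hxc)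
    exact fun s hs => ⟨hs.1, subset_convexHull ℝ S hs.1, hs.2⟩
  · refine convexHull_min inter_subset_right ?_
    exact (convex_convexHull ℝ S).inter (convex_hyperplane l.isLinear c)

theorem IsFace.isPolytope {P F : Set E} (hP : IsPolytope P) (hF : IsFace P F) :
    IsPolytope F := by
  obtain ⟨S, hS, rfl⟩ := hP
  exact ⟨S ∩ F, hS.inter_of_left F, isFace_convexHull_eq hF⟩

theorem IsPolytope.finite_isFace {P : Set E} (hP : IsPolytope P) : {F | IsFace P F}.Finite := by
  obtain ⟨S, hS, rfl⟩ := hP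
  refine (hS.finite_subsets.image (convexHull ℝ)).subset fun F hF => ?_
  exact ⟨S ∩ F, inter_subset_left, (isFace_convexHull_eq hF).symm⟩

/-- A segment that ends in a point of the relative interior can be prolonged. -/
theorem exists_prolong_mem_of_mem_intrinsicInterior {P : Set E} {x y : E}
    (hx : x ∈ intrinsicInterior ℝ P) (hy : y ∈ P) : ∃ ε > (0 : ℝ), x + ε • (x - y) ∈ P := by
  have hxP := intrinsicInterior_subset hx
  obtain ⟨z, hz, rfl⟩ := mem_intrinsicInterior.1 hx
  have hmem : ∀ ε : ℝ, (z : E) + ε • ((z : E) - y) ∈ affineSpan ℝ P := by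
    intro ε
    have := AffineMap.lineMap_mem (1 + ε) (subset_affineSpan ℝ P hy) (subset_affineSpan ℝ P hxP)
    convert this using 1
    rw [AffineMap.lineMap_apply]
    simp only [vsub_eq_sub, vadd_eq_add]
    module
  let g : ℝ → affineSpan ℝ P := fun ε => ⟨(z : E) + ε • ((z : E) - y), hmem ε⟩
  have hg : Continuous g := by
    refine Continuous.subtype_mk ?_ _
    fun_prop
  have hg0 : g 0 = z := Subtype.ext (by simp [g])
  have hnhds : g ⁻¹' ((↑) ⁻¹' P) ∈ nhds (0 : ℝ) := by
    refine hg.continuousAt.preimage_mem_nhds ?_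
    rw [hg0]
    exact mem_interior_iff_mem_nhds.1 hz
  obtain ⟨δ, hδ, hball⟩ := Metric.mem_nhds_iff.1 hnhds
  refine ⟨δ / 2, half_pos hδ, ?_⟩
  have : δ / 2 ∈ Metric.ball (0 : ℝ) δ := by
    rw [Metric.mem_ball, dist_zero_right, Real.norm_of_nonneg (half_pos hδ).le]
    exact half_lt_self hδ
  exact hball this

/-- If the form exceeded its minimum at some `y`, prolonging the segment from `y` slightly beyond
`x` would take it below the minimum. -/
theorem IsFace.eq_of_mem_intrinsicInterior {P F : Set E} (hF : IsFace P F) {x : E}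
    (hx : x ∈ intrinsicInterior ℝ P) (hxF : x ∈ F) : F = P := by
  obtain ⟨-, l, c, hl, rfl⟩ := hF
  refine Subset.antisymm (fun y hy => hy.1) fun y hy => ⟨hy, ?_⟩
  obtain ⟨ε, hε, h⟩ := exists_prolong_mem_of_mem_intrinsicInterior hx hy
  have h1 := hl _ h
  have h2 := hl _ hy
  rw [map_add, map_smul, map_sub, hxF.2, smul_eq_mul] at h1
  nlinarith

/-- A face that contains a relatively interior point of another face contains that face. -/
theorem IsFace.subset_of_mem_intrinsicInterior {P F G : Set E} (hF : IsFace P F) (hG : IsFace P G)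
    {x : E} (hx : x ∈ intrinsicInterior ℝ F) (hxG : x ∈ G) : F ⊆ G := by
  have hxF := intrinsicInterior_subset hx
  have h : IsFace F (F ∩ G) := by
    obtain ⟨-, l, c, hl, rfl⟩ := hG
    refine ⟨⟨x, hxF, hxG⟩, l, c, fun y hy => hl y (hF.subset hy), ?_⟩
    ext y
    exact ⟨fun h => ⟨h.1, h.2.2⟩, fun h => ⟨h.1, hF.subset h.1, h.2⟩⟩
  exact inter_eq_left.1 (h.eq_of_mem_intrinsicInterior hx ⟨hxF, hxG⟩)

theorem IsFace.eq_of_mem_intrinsicInterior_of_mem {P F G : Set E} (hF : IsFace P F)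
    (hG : IsFace P G) {x : E} (hx : x ∈ intrinsicInterior ℝ F) (hxG : x ∈ intrinsicInterior ℝ G) :
    F = G :=
  (hF.subset_of_mem_intrinsicInterior hG hx (intrinsicInterior_subset hxG)).antisymm
    (hG.subset_of_mem_intrinsicInterior hF hxG (intrinsicInterior_subset hx))

/-- Supporting hyperplane: a point of a convex set outside its relative interior lies in a
proper face. -/
theorem exists_isFace_of_notMem_intrinsicInterior [FiniteDimensional ℝ E] {P : Set E}
    (hP : Convex ℝ P) {x : E} (hx : x ∈ P) (hxi : x ∉ intrinsicInterior ℝ P) :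
    ∃ F, IsFace P F ∧ x ∈ F ∧ F ≠ P := by
  obtain ⟨b, hb⟩ := Set.Nonempty.intrinsicInterior hP ⟨x, hx⟩
  have hbP := intrinsicInterior_subset hb
  obtain ⟨b', hb', rfl⟩ := mem_intrinsicInterior.1 hb
  -- Translating by `b'` turns the interior relative to the affine span into an ordinary interior in
  -- the direction space, where Hahn–Banach applies.
  let V := (affineSpan ℝ P).direction
  let h : V ≃ₜ affineSpan ℝ P :=
    { toFun := fun v => ⟨(v : E) + b', AffineSubspace.vadd_mem_of_mem_direction v.2 b'.2⟩
      invFun := fun p => ⟨(p : E) - b', AffineSubspace.vsub_mem_direction p.2 b'.2⟩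
      left_inv := fun v => by simp
      right_inv := fun p => by simp
      continuous_toFun := by
        refine Continuous.subtype_mk (f := fun v : V => (v : E) + (b' : E)) ?_ _
        fun_prop
      continuous_invFun := by
        refine Continuous.subtype_mk (f := fun p : affineSpan ℝ P => (p : E) - (b' : E)) ?_ _
        fun_prop }
  have hval : ∀ v : V, ((h v : affineSpan ℝ P) : E) = v + b' := fun v => rfl
  let Q : Set V := h ⁻¹' ((↑) ⁻¹' P)
  have hQ : Convex ℝ Q := by
    intro v hv w hw s t hs ht hst
    have := hP hv hw hs ht hst
    change ((h _ : affineSpan ℝ P) : E) ∈ P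
    rw [hval] at this ⊢
    rw [hval] at this
    convert this using 1
    obtain rfl : t = 1 - s := by linarith
    simp only [Submodule.coe_add, Submodule.coe_smul]
    module
  have hint : interior Q = h ⁻¹' interior ((↑) ⁻¹' P) := (h.preimage_interior _).symm
  let x' : V := ⟨x - b', AffineSubspace.vsub_mem_direction (subset_affineSpan ℝ P hx) b'.2⟩
  have hx' : ((h x' : affineSpan ℝ P) : E) = x := by rw [hval]; simp [x']
  have hx'Q : x' ∈ Q := by change ((h x' : affineSpan ℝ P) : E) ∈ P; rwa [hx']
  have hx'i : x' ∉ interior Q := by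
    rw [hint]
    exact fun hmem => hxi (mem_intrinsicInterior.2 ⟨h x', hmem, hx'⟩)
  have h0 : (0 : V) ∈ interior Q := by
    rw [hint]
    rw [mem_preimage]
    convert hb'
    exact Subtype.ext (by rw [hval]; simp)
  obtain ⟨f, hf⟩ := geometric_hahn_banach_open_point hQ.interior isOpen_interior hx'i
  have hle : ∀ v ∈ Q, f v ≤ f x' := by
    intro v hv
    have h1 : v ∈ closure (interior Q) := by
      rw [hQ.closure_interior_eq_closure_of_nonempty_interior ⟨0, h0⟩]
      exact subset_closure hv
    exact closure_minimal (fun w hw => (hf w hw).le)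
      (isClosed_le f.continuous continuous_const) h1
  -- Faces are cut out by minima and `f` is maximal at `x'`, so the face uses `-l`. It is proper
  -- because `f 0 < f x'` excludes `b'`.
  obtain ⟨l, hl⟩ := LinearMap.exists_extend (f : V →ₗ[ℝ] ℝ)
  have hlv : ∀ v : V, l v = f v := fun v => LinearMap.congr_fun hl v
  have hly : ∀ y (hy : y ∈ P), l y = f ⟨y - b', AffineSubspace.vsub_mem_direction
      (subset_affineSpan ℝ P hy) b'.2⟩ + l b' := by
    intro y hy
    rw [← hlv]
    simp
  refine ⟨{y ∈ P | (-l) y = (-l) x}, ⟨⟨x, hx, rfl⟩, -l, _, fun y hy => ?_, rfl⟩, ⟨hx, rfl⟩, ?_⟩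
  · simp only [LinearMap.neg_apply, neg_le_neg_iff]
    rw [hly y hy, hly x hx]
    refine add_le_add_left (hle _ ?_) _
    change ((h _ : affineSpan ℝ P) : E) ∈ P
    rw [hval]
    simpa using hy
  · intro heq
    have h1 : (b' : E) ∈ {y ∈ P | (-l) y = (-l) x} := heq.ge hbP
    have h2 := h1.2
    simp only [LinearMap.neg_apply, neg_inj] at h2
    rw [hly x hx] at h2
    have h3 := hf 0 h0
    rw [map_zero] at h3
    change 0 < f ⟨x - b', _⟩ at h3
    linarith

/-- Every point of a polytope lies in the relative interior of a face. -/
theorem IsPolytope.exists_isFace_mem_intrinsicInterior [FiniteDimensional ℝ E] {P : Set E}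
    (hP : IsPolytope P) {x : E} (hx : x ∈ P) : ∃ F, IsFace P F ∧ x ∈ intrinsicInterior ℝ F := by
  have hfin : {F | IsFace P F ∧ x ∈ F}.Finite := hP.finite_isFace.subset fun F hF => hF.1
  obtain ⟨F, hF⟩ := hfin.exists_minimal ⟨P, IsFace.refl ⟨x, hx⟩, hx⟩
  refine ⟨F, hF.prop.1, ?_⟩
  by_contra hxi
  obtain ⟨G, hG, hxG, hne⟩ := exists_isFace_of_notMem_intrinsicInterior
    (hF.prop.1.isPolytope hP).convex hF.prop.2 hxi
  exact hne (hG.subset.antisymm (hF.le_of_le ⟨IsFace.trans hP hF.prop.1 hG, hxG⟩ hG.subset))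

/-- Otherwise a proper face supports `P` at the point. Its form is strictly above the minimum at
`b`, which has positive weight `1 - a`, and at least the minimum at `x`: a contradiction. -/
theorem Convex.lineMap_mem_intrinsicInterior [FiniteDimensional ℝ E] {P : Set E}
    (hP : Convex ℝ P) {b x : E} (hb : b ∈ intrinsicInterior ℝ P) (hx : x ∈ P) {a : ℝ}
    (ha0 : 0 ≤ a) (ha1 : a < 1) : AffineMap.lineMap b x a ∈ intrinsicInterior ℝ P := by
  have hbP := intrinsicInterior_subset hb
  by_contra hn
  obtain ⟨F, hF, hm, hne⟩ := exists_isFace_of_notMem_intrinsicInterior hP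
    (hP.lineMap_mem hbP hx ⟨ha0, ha1.le⟩) hn
  obtain ⟨-, l, c, hl, rfl⟩ := id hF
  have hlb : c < l b := lt_of_le_of_ne (hl b hbP) fun h =>
    hne (hF.eq_of_mem_intrinsicInterior hb ⟨hbP, h.symm⟩)
  have h1 := hm.2
  rw [AffineMap.lineMap_apply_module, map_add, map_smul, map_smul, smul_eq_mul, smul_eq_mul] at h1
  have h2 := hl x hx
  nlinarith [mul_nonneg ha0 (sub_nonneg.2 h2), mul_pos (sub_pos.2 ha1) (sub_pos.2 hlb)]

/-- Uniqueness of polar coordinates around a relatively interior point of a convex set. -/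
theorem Convex.lineMap_injective_of_notMem_intrinsicInterior [FiniteDimensional ℝ E] {P : Set E}
    (hP : Convex ℝ P) {b x x' : E} (hb : b ∈ intrinsicInterior ℝ P) (hx : x ∈ P) (hx' : x' ∈ P)
    (hxi : x ∉ intrinsicInterior ℝ P) (hxi' : x' ∉ intrinsicInterior ℝ P) {a a' : ℝ}
    (ha : 0 < a) (ha' : 0 < a') (h : AffineMap.lineMap b x a = AffineMap.lineMap b x' a') :
    a = a' ∧ x = x' := by
  -- With `l` supporting `P` at `x'` with minimum `c`, the equation gives `(a - a') (l b - c) = a (l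
  -- x - c) ≥ 0`.
  have hle : ∀ {x x' : E} {a a' : ℝ}, x ∈ P → x' ∈ P → x' ∉ intrinsicInterior ℝ P → 0 < a →
      AffineMap.lineMap b x a = AffineMap.lineMap b x' a' → a' ≤ a := by
    intro x x' a a' hx hx' hxi' ha h
    have hbP := intrinsicInterior_subset hb
    obtain ⟨F, hF, hm, hne⟩ := exists_isFace_of_notMem_intrinsicInterior hP hx' hxi'
    obtain ⟨-, l, c, hl, rfl⟩ := id hF
    have hlb : c < l b := lt_of_le_of_ne (hl b hbP) fun h =>
      hne (hF.eq_of_mem_intrinsicInterior hb ⟨hbP, h.symm⟩)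
    have h1 := congrArg l h
    rw [AffineMap.lineMap_apply_module, AffineMap.lineMap_apply_module, map_add, map_add, map_smul,
      map_smul, map_smul, map_smul, hm.2] at h1
    simp only [smul_eq_mul] at h1
    have h2 := mul_nonneg ha.le (sub_nonneg.2 (hl x hx))
    by_contra hlt
    push Not at hlt
    nlinarith [mul_pos (sub_pos.2 hlt) (sub_pos.2 hlb)]
  have haa : a = a' := le_antisymm (hle hx' hx hxi ha' h.symm) (hle hx hx' hxi' ha h)
  subst haa
  refine ⟨rfl, ?_⟩
  rw [AffineMap.lineMap_apply, AffineMap.lineMap_apply] at h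
  simp only [vsub_eq_sub, vadd_eq_add, add_left_inj] at h
  exact sub_left_injective (smul_right_injective E ha.ne' h)

/-- Existence of polar coordinates around a relatively interior point of a compact convex set. -/
theorem exists_lineMap_eq_of_mem {P : Set E} (hPc : IsCompact P)
    {b x : E} (hb : b ∈ P) (hx : x ∈ P) (hxb : x ≠ b) :
    ∃ y ∈ P, y ∉ intrinsicInterior ℝ P ∧ ∃ a : ℝ, 0 < a ∧ a ≤ 1 ∧ AffineMap.lineMap b y a = x := by
  let g : ℝ → E := AffineMap.lineMap b x
  have hgc : Continuous g := AffineMap.lineMap_continuous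
  have hpos : 0 < dist b x := dist_pos.2 hxb.symm
  have hT : IsCompact (g ⁻¹' P ∩ Ici 1) := by
    refine Metric.isCompact_of_isClosed_isBounded
      ((hPc.isClosed.preimage hgc).inter isClosed_Ici) ?_
    obtain ⟨R, hR⟩ := hPc.isBounded.subset_closedBall b
    refine (Metric.isBounded_closedBall (x := (0 : ℝ)) (r := R / dist b x)).subset fun s hs => ?_
    have h1 := hR hs.1
    rw [Metric.mem_closedBall, dist_lineMap_left] at h1
    rwa [Metric.mem_closedBall, dist_zero_right, le_div_iff₀ hpos]
  -- The boundary point is where the ray leaves `P`: the largest parameter `s ≥ 1` still in `P`, so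
  -- that `x` sits at ratio `s⁻¹`.
  obtain ⟨s, ⟨hsP, hs1⟩, hmax⟩ := hT.exists_isMaxOn ⟨1, by simpa [g] using hx, self_mem_Ici⟩
    continuousOn_id
  have hs0 : (0 : ℝ) < s := lt_of_lt_of_le one_pos hs1
  refine ⟨g s, hsP, fun hi => ?_, s⁻¹, inv_pos.2 hs0, inv_le_one_of_one_le₀ hs1, ?_⟩
  · obtain ⟨ε, hε, hmem⟩ := exists_prolong_mem_of_mem_intrinsicInterior hi hb
    have h1 : g (s + ε * s) ∈ P := by
      convert hmem using 1
      simp only [g, AffineMap.lineMap_apply, vsub_eq_sub, vadd_eq_add]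
      module
    have h3 : s + ε * s ≤ s := hmax ⟨h1, by
      have : (1 : ℝ) ≤ s := hs1
      have := mul_pos hε hs0
      change (1 : ℝ) ≤ _
      linarith⟩
    nlinarith [mul_pos hε hs0]
  · simp only [g, AffineMap.lineMap_apply, vsub_eq_sub, vadd_eq_add, add_sub_cancel_right, smul_smul,
      inv_mul_cancel₀ hs0.ne', one_smul, sub_add_cancel]

theorem Convex.subset_closure_intrinsicInterior [FiniteDimensional ℝ E] {P : Set E}
    (hP : Convex ℝ P) : P ⊆ closure (intrinsicInterior ℝ P) := by
  intro x hx
  obtain ⟨b, hb⟩ := Set.Nonempty.intrinsicInterior hP ⟨x, hx⟩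
  have h1 : Filter.Tendsto (fun a : ℝ => AffineMap.lineMap b x a) (nhdsWithin 1 (Iio 1))
      (nhds x) := by
    have : ContinuousAt (fun a : ℝ => AffineMap.lineMap b x a) 1 :=
      (AffineMap.lineMap_continuous (p := b) (q := x)).continuousAt
    simpa using this.tendsto.mono_left nhdsWithin_le_nhds
  refine mem_closure_of_tendsto h1 ?_
  filter_upwards [Ioo_mem_nhdsLT (zero_lt_one (α := ℝ))] with a ha
  exact hP.lineMap_mem_intrinsicInterior hb hx ha.1.le ha.2

end ConvexGeometry

/-- The inverse of a polyhedral homeomorphism maps relatively interior points to relatively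
interior points. -/
theorem IsPolyhedral.mem_intrinsicInterior {E E' : Type*} [NormedAddCommGroup E] [NormedSpace ℝ E]
    [FiniteDimensional ℝ E] [NormedAddCommGroup E'] [NormedSpace ℝ E'] {P : Set E} {Q : Set E'}
    {f : P ≃ₜ Q} (hf : IsPolyhedral f) (hP : Convex ℝ P) {x : P}
    (hx : (f x : E') ∈ intrinsicInterior ℝ Q) : (x : E) ∈ intrinsicInterior ℝ P := by
  by_contra hxi
  obtain ⟨F, hF, hxF, hne⟩ := exists_isFace_of_notMem_intrinsicInterior hP x.2 hxi
  have h := (hf F hF).eq_of_mem_intrinsicInterior hx ⟨x, hxF, rfl⟩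
  refine hne (hF.subset.antisymm fun y hy => ?_)
  obtain ⟨z, hz, hzy⟩ := h.ge (f ⟨y, hy⟩).2
  have := f.injective (Subtype.ext hzy)
  subst this
  exact hz

/-! ### Open cells and face maps -/

namespace PolyhedralCWComplex

open Set

variable {K : Type u} [TopologicalSpace K] (X : PolyhedralCWComplex.{u, v} K)

/-- The points of the polytope `P α` in its relative interior. -/
def relInt (α : X.ι) : Set (X.P α) :=
  {x | (x : EuclideanSpace ℝ (Fin (X.dim α))) ∈ intrinsicInterior ℝ (X.P α)}

theorem convex (α : X.ι) : Convex ℝ (X.P α) := (X.isPolytope α).convex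

theorem relInt_nonempty (α : X.ι) : (X.relInt α).Nonempty := by
  obtain ⟨b, hb⟩ := (X.nonempty α).intrinsicInterior (X.convex α)
  exact ⟨⟨b, intrinsicInterior_subset hb⟩, hb⟩

/-- Stated in the disjoint union so that the cell and the point are recovered together. -/
theorem map_injective_on_relInt {α β : X.ι} {x : X.P α} {y : X.P β} (hx : x ∈ X.relInt α)
    (hy : y ∈ X.relInt β) (h : X.map α x = X.map β y) :
    (⟨α, x⟩ : Σ α, X.P α) = ⟨β, y⟩ := by
  by_cases hαβ : α = β
  · subst hαβ
    have := (X.isEmbedding α).injective (a₁ := ⟨x, hx⟩) (a₂ := ⟨y, hy⟩) h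
    rw [Subtype.mk.inj this]
  · exact (Set.disjoint_left.1 (X.disjoint hαβ) ⟨x, hx, rfl⟩ ⟨y, hy, h.symm⟩).elim

theorem exists_mem_relInt_map_eq (k : K) : ∃ α, ∃ x ∈ X.relInt α, X.map α x = k := by
  have h : k ∈ (Set.univ : Set K) := Set.mem_univ k
  rw [← X.cover, Set.mem_iUnion] at h
  exact h

variable {X}

namespace IsFaceMap

variable {α β : X.ι} {φ : X.P β → X.P α}

/-- The face parametrized by a face map. -/
abbrev face (_ : X.IsFaceMap β α φ) : Set (EuclideanSpace ℝ (Fin (X.dim α))) :=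
  range fun x => (φ x : EuclideanSpace ℝ (Fin (X.dim α)))

theorem exists_homeomorph (hφ : X.IsFaceMap β α φ) : ∃ e : X.P β ≃ₜ hφ.face,
    IsPolyhedral e ∧ ∀ x, (e x : EuclideanSpace ℝ (Fin (X.dim α))) = φ x := by
  obtain ⟨F, hF, e, he, hφe, hm⟩ := _root_.id hφ
  have hFr : F = hφ.face := by
    ext y
    constructor
    · intro hy
      exact ⟨e.symm ⟨y, hy⟩, by simp [hφe]⟩
    · rintro ⟨x, rfl⟩
      simp [hφe]
  subst hFr
  exact ⟨e, he, fun x => by simp [hφe]⟩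

theorem map_eq (hφ : X.IsFaceMap β α φ) (x : X.P β) : X.map α (φ x) = X.map β x := by
  obtain ⟨F, hF, e, he, hφe, hm⟩ := _root_.id hφ
  exact (hm x).symm

theorem isFace (hφ : X.IsFaceMap β α φ) : IsFace (X.P α) hφ.face := by
  obtain ⟨F, hF, e, he, hφe, hm⟩ := _root_.id hφ
  convert hF
  ext y
  constructor
  · rintro ⟨x, rfl⟩
    simp [hφe]
  · intro hy
    exact ⟨e.symm ⟨y, hy⟩, by simp [hφe]⟩

theorem injective (hφ : X.IsFaceMap β α φ) : Function.Injective φ := by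
  obtain ⟨e, -, he⟩ := hφ.exists_homeomorph
  exact fun x y h => e.injective (Subtype.ext (by rw [he, he, h]))

theorem continuous (hφ : X.IsFaceMap β α φ) : Continuous φ := by
  obtain ⟨e, -, he⟩ := hφ.exists_homeomorph
  have : (fun x => (φ x : EuclideanSpace ℝ (Fin (X.dim α)))) =
      fun x => (e x : EuclideanSpace ℝ (Fin (X.dim α))) :=
    funext fun x => (he x).symm
  rw [continuous_induced_rng]
  change Continuous fun x => (φ x : EuclideanSpace ℝ (Fin (X.dim α)))
  rw [this]
  exact continuous_subtype_val.comp e.continuous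

theorem isFace_image (hφ : X.IsFaceMap β α φ) {G : Set (EuclideanSpace ℝ (Fin (X.dim β)))}
    (hG : IsFace (X.P β) G) : IsFace (X.P α)
      ((fun x => (φ x : EuclideanSpace ℝ (Fin (X.dim α)))) ''
        {x | (x : EuclideanSpace ℝ _) ∈ G}) := by
  obtain ⟨e, hp, he⟩ := hφ.exists_homeomorph
  refine IsFace.trans (X.isPolytope α) hφ.isFace ?_
  have h := hp G hG
  simp only [he] at h
  exact h

theorem mem_relInt_of_mem_face (hφ : X.IsFaceMap β α φ) {x : X.P β}
    (hx : (φ x : EuclideanSpace ℝ (Fin (X.dim α))) ∈ intrinsicInterior ℝ hφ.face) :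
    x ∈ X.relInt β := by
  obtain ⟨e, hp, he⟩ := hφ.exists_homeomorph
  exact hp.mem_intrinsicInterior (X.convex β) (by rwa [he])

/-- Equality of two continuous face maps need then be checked only over the relative interior of the
face. -/
theorem dense_preimage (hφ : X.IsFaceMap β α φ) :
    Dense {x | (φ x : EuclideanSpace ℝ (Fin (X.dim α))) ∈ intrinsicInterior ℝ hφ.face} := by
  obtain ⟨e, hp, he⟩ := hφ.exists_homeomorph
  have h1 : Dense {y : hφ.face |
      (y : EuclideanSpace ℝ (Fin (X.dim α))) ∈ intrinsicInterior ℝ hφ.face} := by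
    rw [Subtype.dense_iff]
    intro y hy
    have := (hφ.isFace.isPolytope (X.isPolytope α)).convex.subset_closure_intrinsicInterior hy
    convert this using 1
    refine congrArg closure (Set.ext fun z => ?_)
    exact ⟨fun ⟨w, hw, hwz⟩ => hwz ▸ hw, fun hz => ⟨⟨z, intrinsicInterior_subset hz⟩, hz, rfl⟩⟩
  have h2 := h1.preimage e.isOpenMap
  convert h2 using 1
  ext x
  simp [he]

end IsFaceMap

theorem exists_isFaceMap (α : X.ι) {F : Set (EuclideanSpace ℝ (Fin (X.dim α)))}
    (hF : IsFace (X.P α) F) : ∃ (β : X.ι) (φ : X.P β → X.P α) (hφ : X.IsFaceMap β α φ),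
      hφ.face = F := by
  obtain ⟨β, e, he, hm⟩ := X.exists_face α F hF
  refine ⟨β, fun x => Set.inclusion hF.subset (e x), ⟨F, hF, e, he, fun x => rfl, hm⟩, ?_⟩
  ext y
  constructor
  · rintro ⟨x, rfl⟩
    exact (e x).2
  · intro hy
    exact ⟨e.symm ⟨y, hy⟩, by simp⟩

/-- Every point of `P α` is the image of a relatively interior point under a face map. -/
theorem exists_isFaceMap_apply_eq (α : X.ι) (y : X.P α) :
    ∃ (β : X.ι) (φ : X.P β → X.P α) (hφ : X.IsFaceMap β α φ), ∃ x ∈ X.relInt β, φ x = y ∧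
      (y : EuclideanSpace ℝ (Fin (X.dim α))) ∈ intrinsicInterior ℝ hφ.face := by
  obtain ⟨G, hG, hyG⟩ := (X.isPolytope α).exists_isFace_mem_intrinsicInterior y.2
  obtain ⟨β, φ, hφ, rfl⟩ := exists_isFaceMap α hG
  obtain ⟨x, hx⟩ := intrinsicInterior_subset hyG
  have hx' : φ x = y := Subtype.ext hx
  subst hx'
  exact ⟨β, φ, hφ, x, hφ.mem_relInt_of_mem_face hyG, rfl, hyG⟩

namespace IsFaceMap

variable {α β : X.ι} {φ : X.P β → X.P α}

/-- A face map sends relatively interior points to relatively interior points of the face. -/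
theorem mem_intrinsicInterior_face (hφ : X.IsFaceMap β α φ) {x : X.P β} (hx : x ∈ X.relInt β) :
    (φ x : EuclideanSpace ℝ (Fin (X.dim α))) ∈ intrinsicInterior ℝ hφ.face := by
  -- Polyhedrality controls images of faces, not preimages, so the cell structure is used instead.
  -- The face containing `φ x` in its relative interior is parametrized by some `φ'`, and
  -- disjointness of open cells forces `β' = β` and `x' = x`. It remains to see that `φ = φ'`.
  obtain ⟨β', φ', hφ', x', hx', hxx', hi⟩ := exists_isFaceMap_apply_eq α (φ x)
  have hG := hφ'.isFace
  have h1 : X.map β' x' = X.map β x := by rw [← hφ'.map_eq, ← hφ.map_eq, hxx']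
  have h2 := X.map_injective_on_relInt hx' hx h1
  obtain ⟨rfl, h3⟩ := Sigma.mk.inj h2
  obtain rfl := eq_of_heq h3
  have hGF : hφ'.face ⊆ hφ.face := hG.subset_of_mem_intrinsicInterior hφ.isFace hi ⟨x', rfl⟩
  have heq : φ = φ' := by
    refine hφ.continuous.ext_on hφ'.dense_preimage hφ'.continuous fun w hw => ?_
    obtain ⟨v, hv⟩ := hGF (intrinsicInterior_subset hw)
    have hv' : φ v = φ' w := Subtype.ext hv
    -- If `v` lay in a proper face `H`, the face `φ(H)` would meet the relative interior of
    -- `hφ'.face` and so contain it, in particular `φ x'`. Then `x' ∈ H` by injectivity, although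
    -- `x'` is relatively interior.
    have hvi : v ∈ X.relInt β' := by
      by_contra hvi
      obtain ⟨H, hH, hvH, hne⟩ := exists_isFace_of_notMem_intrinsicInterior (X.convex β') v.2 hvi
      have hsub := hG.subset_of_mem_intrinsicInterior (hφ.isFace_image hH) hw ⟨v, hvH, hv⟩
      obtain ⟨z, hz, hzx⟩ := hsub (intrinsicInterior_subset hi)
      have hzx' : z = x' := hφ.injective (Subtype.ext hzx)
      subst hzx'
      exact hne (hH.eq_of_mem_intrinsicInterior hx hz)
    have hwi := hφ'.mem_relInt_of_mem_face hw
    have h4 := X.map_injective_on_relInt hvi hwi (by rw [← hφ.map_eq, ← hφ'.map_eq, hv'])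
    obtain rfl := eq_of_heq (Sigma.mk.inj h4).2
    exact hv'
  subst heq
  exact hi

/-- Over the relative interior of the face, the preimages under both maps are relatively interior
and have the same image in `K`, hence coincide; density does the rest. -/
theorem ext_of_face_eq {β' : X.ι} {φ' : X.P β' → X.P α} (hφ : X.IsFaceMap β α φ)
    (hφ' : X.IsFaceMap β' α φ') (h : hφ.face = hφ'.face) :
    (⟨β, φ⟩ : Σ β, X.P β → X.P α) = ⟨β', φ'⟩ := by
  have key : ∀ w ∈ X.relInt β, ∃ v ∈ X.relInt β', φ' v = φ w ∧
      (⟨β, w⟩ : Σ β, X.P β) = ⟨β', v⟩ := by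
    intro w hw
    have h1 := hφ.mem_intrinsicInterior_face hw
    rw [h] at h1
    obtain ⟨v, hv⟩ := intrinsicInterior_subset h1
    have hv' : φ' v = φ w := Subtype.ext hv
    have hvi := hφ'.mem_relInt_of_mem_face (x := v) (by rwa [hv'])
    exact ⟨v, hvi, hv',
      X.map_injective_on_relInt hw hvi (by rw [← hφ.map_eq, ← hφ'.map_eq, hv'])⟩
  obtain ⟨z, hz⟩ := X.relInt_nonempty β
  obtain ⟨v, -, -, hvz⟩ := key z hz
  obtain rfl := (Sigma.mk.inj hvz).1
  have : φ = φ' := by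
    refine hφ.continuous.ext_on hφ.dense_preimage hφ'.continuous fun w hw => ?_
    obtain ⟨v, -, hv, hwv⟩ := key w (hφ.mem_relInt_of_mem_face hw)
    obtain rfl := eq_of_heq (Sigma.mk.inj hwv).2
    exact hv.symm
  rw [this]

/-- A point of `P α` comes from a relatively interior point under a unique face map. -/
theorem ext_of_apply_eq {β' : X.ι} {φ' : X.P β' → X.P α} (hφ : X.IsFaceMap β α φ)
    (hφ' : X.IsFaceMap β' α φ') {z : X.P β} {z' : X.P β'} (hz : z ∈ X.relInt β)
    (hz' : z' ∈ X.relInt β') (h : φ z = φ' z') :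
    (⟨β, φ⟩ : Σ β, X.P β → X.P α) = ⟨β', φ'⟩ :=
  hφ.ext_of_face_eq hφ' (hφ.isFace.eq_of_mem_intrinsicInterior_of_mem hφ'.isFace
    (hφ.mem_intrinsicInterior_face hz) (by rw [h]; exact hφ'.mem_intrinsicInterior_face hz'))

end IsFaceMap

/-! ### The face category -/

/-- The cell that is an object of the face category. -/
def FaceCategory.cell (α : X.FaceCategory) : X.ι := α

/-- The face map that is a morphism of the face category. -/
def faceMap {α β : X.FaceCategory} (f : β ⟶ α) : X.P β.cell → X.P α.cell := f.1

theorem isFaceMap_faceMap {α β : X.FaceCategory} (f : β ⟶ α) :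
    X.IsFaceMap β.cell α.cell (faceMap f) := f.2

theorem FaceCategory.ext_of_apply_eq {α β β' : X.FaceCategory} {f : β ⟶ α} {f' : β' ⟶ α}
    {z : X.P β.cell} {z' : X.P β'.cell} (hz : z ∈ X.relInt β.cell)
    (hz' : z' ∈ X.relInt β'.cell)
    (h : faceMap f z = faceMap f' z') : ∃ _ : β = β', HEq f f' ∧ HEq z z' := by
  have h1 := IsFaceMap.ext_of_apply_eq f.2 f'.2 hz hz' h
  obtain ⟨rfl, h2⟩ := Sigma.mk.inj h1
  obtain rfl : f = f' := Subtype.ext (eq_of_heq h2)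
  exact ⟨rfl, HEq.rfl, heq_of_eq (f.2.injective h)⟩

theorem not_isNonIdentity_id {C : Type*} [Category C] (x : C) : ¬ IsNonIdentity (𝟙 x) :=
  fun h => h rfl rfl

/-- A morphism of the face category is not an identity if and only if it is a map to the relative
boundary. -/
theorem isNonIdentity_iff {α β : X.FaceCategory} (f : β ⟶ α) :
    IsNonIdentity f ↔ ∀ x, faceMap f x ∉ X.relInt α.cell := by
  constructor
  · intro hf x hx
    have hface : f.2.face = X.P α := f.2.isFace.eq_of_mem_intrinsicInterior hx ⟨x, rfl⟩
    have hxi : x ∈ X.relInt β := f.2.mem_relInt_of_mem_face (by rw [hface]; exact hx)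
    obtain ⟨rfl, h1, -⟩ := FaceCategory.ext_of_apply_eq (f := f) (f' := 𝟙 α) hxi hx rfl
    rw [eq_of_heq h1] at hf
    exact not_isNonIdentity_id _ hf
  · rintro h rfl rfl
    obtain ⟨z, hz⟩ := X.relInt_nonempty β
    exact h z hz

theorem IsNonIdentity.comp_left {α β γ : X.FaceCategory} (f : γ ⟶ β) {g : β ⟶ α}
    (hg : IsNonIdentity g) : IsNonIdentity (f ≫ g) := by
  rw [isNonIdentity_iff] at hg ⊢
  exact fun x => hg (f.1 x)

theorem exists_isNonIdentity_apply_eq {α : X.FaceCategory} {y : X.P α.cell}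
    (hy : y ∉ X.relInt α.cell) :
    ∃ (β : X.FaceCategory) (f : β ⟶ α) (x : X.P β.cell), IsNonIdentity f ∧ faceMap f x = y := by
  obtain ⟨β, φ, hφ, x, hx, rfl, -⟩ := exists_isFaceMap_apply_eq α y
  refine ⟨β, ⟨φ, hφ⟩, x, ?_, rfl⟩
  rintro rfl h
  refine hy ?_
  have : φ = id := congrArg Subtype.val h
  rw [this]
  exact hx

/-- Only finitely many morphisms of the face category end at a given object. -/
instance (α : X.FaceCategory) : Finite (Σ β : X.FaceCategory, β ⟶ α) := by
  have := (X.isPolytope α).finite_isFace.to_subtype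
  refine Finite.of_injective
    (fun p : Σ β : X.FaceCategory, β ⟶ α =>
      (⟨p.2.2.face, p.2.2.isFace⟩ : {F | IsFace (X.P α) F})) ?_
  rintro ⟨β, f⟩ ⟨β', f'⟩ h
  obtain ⟨rfl, h2⟩ := Sigma.mk.inj (f.2.ext_of_face_eq f'.2 (Subtype.mk.inj h))
  rw [show f = f' from Subtype.ext (eq_of_heq h2)]

/-- Non-identity morphisms increase the number of faces. -/
theorem ncard_isFace_lt {α β : X.FaceCategory} {f : β ⟶ α} (hf : IsNonIdentity f) :
    {F | IsFace (X.P β.cell) F}.ncard < {F | IsFace (X.P α.cell) F}.ncard := by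
  let g : Set (EuclideanSpace ℝ (Fin (X.dim β.cell))) →
      Set (EuclideanSpace ℝ (Fin (X.dim α.cell))) :=
    fun G => (fun x => (faceMap f x : EuclideanSpace ℝ (Fin (X.dim α.cell)))) ''
      {x | (x : EuclideanSpace ℝ _) ∈ G}
  have hinj : InjOn g {F | IsFace (X.P β.cell) F} := by
    have : ∀ {F G}, IsFace (X.P β.cell) F → g F = g G → F ⊆ G := by
      intro F G hF h y hy
      obtain ⟨z, hz, hzy⟩ := h.le ⟨⟨y, hF.subset hy⟩, hy, rfl⟩
      have := (isFaceMap_faceMap f).injective (Subtype.ext hzy)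
      subst this
      exact hz
    exact fun F hF G hG h => (this hF h).antisymm (this hG h.symm)
  rw [← hinj.ncard_image]
  refine Set.ncard_lt_ncard ⟨?_, fun hsub => ?_⟩ (X.isPolytope α.cell).finite_isFace
  · rintro _ ⟨G, hG, rfl⟩
    exact (isFaceMap_faceMap f).isFace_image hG
  -- If `P α` itself were the image of a face, `f` would reach a relatively interior point.
  · obtain ⟨G, -, hG⟩ := hsub (IsFace.refl (X.nonempty α.cell))
    obtain ⟨z, hz⟩ := X.relInt_nonempty α.cell
    obtain ⟨x, -, hx⟩ := hG.ge z.2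
    have hx' : faceMap f x = z := Subtype.ext hx
    exact (isNonIdentity_iff f).1 hf x (hx' ▸ hz)

end PolyhedralCWComplex

/-! ### Chains of composable morphisms -/

section Chains

open ComposableArrows

variable {C : Type*} [Category C]

namespace CategoryTheory.ComposableArrows

theorem map_heq {d : ℕ} (F : ComposableArrows C d) {i j i' j' : Fin (d + 1)} (hi : i = i')
    (hj : j = j') (h : i ≤ j) (h' : i' ≤ j') : HEq (F.map (homOfLE h)) (F.map (homOfLE h')) := by
  subst hi hj
  rfl

/-- The last morphism of a chain. -/
def lastMap {d : ℕ} (F : ComposableArrows C (d + 1)) :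
    F.δlast.obj (Fin.last d) ⟶ F.obj (Fin.last (d + 1)) :=
  F.map (homOfLE (Fin.last d).castSucc_le_succ)

/-- Chains are built and compared from their last morphism, matching the recursion of `eval`. `HEq`
is needed because the objects agree only propositionally. -/
theorem ext_of_δlast {d : ℕ} {F G : ComposableArrows C (d + 1)} (h : F.δlast = G.δlast)
    (hobj : F.obj (Fin.last (d + 1)) = G.obj (Fin.last (d + 1)))
    (hmap : HEq F.lastMap G.lastMap) : F = G := by
  have hcast : ∀ i : Fin (d + 1), F.obj i.castSucc = G.obj i.castSucc := fun i =>
    congrArg (fun H : ComposableArrows C d => H.obj i) h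
  have hob : ∀ i, F.obj i = G.obj i := by
    intro i
    induction i using Fin.lastCases with
    | last => exact hobj
    | cast i => exact hcast i
  refine ComposableArrows.ext hob fun i hi => ?_
  have key : HEq (F.map' i (i + 1)) (G.map' i (i + 1)) := by
    rcases (Nat.lt_succ_iff_lt_or_eq.1 hi) with hi' | rfl
    · have : ∀ H H' : ComposableArrows C d, H = H' →
          HEq (H.map' i (i + 1)) (H'.map' i (i + 1)) := by
        rintro H _ rfl
        rfl
      exact this _ _ h
    · exact hmap
  rw [← conj_eqToHom_iff_heq'] at key
  exact key

theorem exists_postcomp {d : ℕ} (F : ComposableArrows C d) {α : C} (f : F.obj (Fin.last d) ⟶ α) :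
    ∃ G : ComposableArrows C (d + 1), G.δlast = F ∧ G.obj (Fin.last (d + 1)) = α ∧
      HEq G.lastMap f := by
  let obj : Fin (d + 2) → C := Fin.snoc (α := fun _ => C) F.obj α
  have hc : ∀ i : Fin (d + 1), obj i.castSucc = F.obj i := fun i =>
    Fin.snoc_castSucc (α := fun _ => C) _ _ _
  have hl : obj (Fin.last (d + 1)) = α := Fin.snoc_last (α := fun _ => C) _ _
  let mapSucc : ∀ i : Fin (d + 1), obj i.castSucc ⟶ obj i.succ :=
    Fin.lastCases (motive := fun i => obj i.castSucc ⟶ obj i.succ)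
      (eqToHom (hc _) ≫ f ≫ eqToHom hl.symm)
      (fun i => eqToHom (hc _) ≫ F.map (homOfLE i.castSucc_le_succ) ≫ eqToHom (hc i.succ).symm)
  refine ⟨mkOfObjOfMapSucc obj mapSucc, ?_, hl, ?_⟩
  · refine ComposableArrows.ext hc fun i hi => ?_
    have h1 := mkOfObjOfMapSucc_map_succ obj mapSucc i (by omega)
    have h2 : mapSucc (Fin.castSucc ⟨i, hi⟩) = _ := Fin.lastCases_castSucc ..
    exact h1.trans h2
  · have h1 := mkOfObjOfMapSucc_map_succ obj mapSucc d (by omega)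
    have h2 : mapSucc (Fin.last d) = _ := Fin.lastCases_last ..
    exact (conj_eqToHom_iff_heq' (mkOfObjOfMapSucc obj mapSucc).lastMap f (hc (Fin.last d))
      hl.symm).1 (h1.trans h2)

/-- The chain obtained by omitting the `i`-th object. -/
abbrev eraseObj {d : ℕ} (F : ComposableArrows C (d + 1)) (i : Fin (d + 2)) : ComposableArrows C d :=
  F.whiskerLeft (Fin.strictMono_succAbove i).monotone.functor

theorem whiskerLeft_congr {d e : ℕ} (F : ComposableArrows C d) {Φ Ψ : Fin (e + 1) ⥤ Fin (d + 1)}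
    (h : ∀ i, Φ.obj i = Ψ.obj i) : F.whiskerLeft Φ = F.whiskerLeft Ψ := by
  rw [show Φ = Ψ from Functor.ext h fun _ _ _ => Subsingleton.elim _ _]

theorem eraseObj_last {d : ℕ} (F : ComposableArrows C (d + 1)) : F.eraseObj (Fin.last _) = F.δlast :=
  F.whiskerLeft_congr fun i => Fin.succAbove_last_apply i

theorem δlast_eraseObj_castSucc {d : ℕ} (F : ComposableArrows C (d + 2)) (i : Fin (d + 2)) :
    (F.eraseObj i.castSucc).δlast = F.δlast.eraseObj i :=
  F.whiskerLeft_congr (Φ := Fin.castSuccFunctor (d + 1) ⋙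
      (Fin.strictMono_succAbove i.castSucc).monotone.functor)
    (Ψ := (Fin.strictMono_succAbove i).monotone.functor ⋙ Fin.castSuccFunctor (d + 2))
    fun _ => Fin.castSucc_succAbove_castSucc

end CategoryTheory.ComposableArrows

end Chains

/-! ### Points of simplices -/

section Simplices

theorem stdSimplex.map_succAbove_apply_self {d : ℕ} (i : Fin (d + 2))
    (s : stdSimplex ℝ (Fin (d + 1))) : stdSimplex.map i.succAbove s i = 0 := by
  rw [stdSimplex.map_coe, FunOnFinite.linearMap_apply_apply]
  exact Finset.sum_eq_zero fun j hj => ((Fin.succAbove_ne i j) (Finset.mem_filter.1 hj).2).elim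

theorem stdSimplex.map_succAbove_apply {d : ℕ} (i : Fin (d + 2))
    (s : stdSimplex ℝ (Fin (d + 1))) (j : Fin (d + 1)) :
    stdSimplex.map i.succAbove s (i.succAbove j) = s j := by
  rw [stdSimplex.map_coe, FunOnFinite.linearMap_apply_apply]
  rw [Finset.sum_eq_single j]
  · intro k hk hkj
    exact (hkj (Fin.succAbove_right_injective (Finset.mem_filter.1 hk).2)).elim
  · intro h
    simp at h

theorem stdSimplex.exists_map_succAbove_eq {d : ℕ} (t : stdSimplex ℝ (Fin (d + 2))) {i : Fin (d + 2)}
    (hi : t i = 0) : ∃ s : stdSimplex ℝ (Fin (d + 1)), stdSimplex.map i.succAbove s = t := by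
  have hsum : ∑ j, t (i.succAbove j) = 1 := by
    have := stdSimplex.sum_eq_one t
    rwa [Fin.sum_univ_succAbove _ i, hi, zero_add] at this
  let s : stdSimplex ℝ (Fin (d + 1)) := ⟨fun j => t (i.succAbove j), fun j => t.2.1 _, hsum⟩
  refine ⟨s, DFunLike.ext _ _ fun k => ?_⟩
  induction k using Fin.succAboveCases i with
  | x => rw [stdSimplex.map_succAbove_apply_self, hi]
  | p j => rw [stdSimplex.map_succAbove_apply]; rfl

end Simplices

namespace PolyhedralCWComplex

open Set ComposableArrows

variable {K : Type u} [TopologicalSpace K] (X : PolyhedralCWComplex.{u, v} K)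

/-! ### Cones -/

/-- A chosen point in the relative interior of `P α`. -/
noncomputable def base (α : X.FaceCategory) : X.P α.cell := (X.relInt_nonempty α.cell).some

theorem base_mem_relInt (α : X.FaceCategory) : X.base α ∈ X.relInt α.cell :=
  (X.relInt_nonempty α.cell).some_mem

variable {X}

/-- The point that divides the segment from the base point of `P α` to the image of `x` under the
face map `f` in the ratio `a : 1 - a`. -/
noncomputable def conePt {α β : X.FaceCategory} (f : β ⟶ α) (x : X.P β.cell) (a : unitInterval) :
    X.P α.cell :=
  ⟨AffineMap.lineMap (X.base α : EuclideanSpace ℝ (Fin (X.dim α.cell)))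
    (faceMap f x : EuclideanSpace ℝ _) (a : ℝ), (X.convex α.cell).lineMap_mem (X.base α).2 (faceMap f x).2 a.2⟩

theorem coe_conePt {α β : X.FaceCategory} (f : β ⟶ α) (x : X.P β.cell) (a : unitInterval) :
    (conePt f x a : EuclideanSpace ℝ (Fin (X.dim α.cell))) =
      AffineMap.lineMap (X.base α : EuclideanSpace ℝ (Fin (X.dim α.cell)))
        (faceMap f x : EuclideanSpace ℝ _) (a : ℝ) := rfl

@[simp]
theorem conePt_zero {α β : X.FaceCategory} (f : β ⟶ α) (x : X.P β.cell) : conePt f x 0 = X.base α :=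
  Subtype.ext (by simp [coe_conePt])

@[simp]
theorem conePt_one {α β : X.FaceCategory} (f : β ⟶ α) (x : X.P β.cell) : conePt f x 1 = faceMap f x :=
  Subtype.ext (by simp [coe_conePt])

theorem continuous_conePt {α β : X.FaceCategory} (f : β ⟶ α) :
    Continuous fun p : X.P β.cell × unitInterval => conePt f p.1 p.2 := by
  have := (isFaceMap_faceMap f).continuous
  refine Continuous.subtype_mk ?_ _
  simp only [AffineMap.lineMap_apply_module]
  fun_prop

/-- The cone construction is continuous at the cone point. -/
theorem tendsto_conePt_zero {T : Type*} {l : Filter T} {α β : X.FaceCategory} (f : β ⟶ α)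
    (x : T → X.P β.cell) {a : T → unitInterval} (ha : Filter.Tendsto a l (nhds 0)) :
    Filter.Tendsto (fun t => conePt f (x t) (a t)) l (nhds (X.base α)) := by
  obtain ⟨R, hR⟩ := (X.isPolytope α.cell).isCompact.isBounded.subset_closedBall
    (X.base α : EuclideanSpace ℝ (Fin (X.dim α.cell)))
  rw [tendsto_iff_dist_tendsto_zero]
  have ha' : Filter.Tendsto (fun t => (a t : ℝ) * R) l (nhds 0) := by
    have h1 : Filter.Tendsto (fun t => (a t : ℝ)) l (nhds (0 : ℝ)) :=
      (continuous_subtype_val.tendsto (0 : unitInterval)).comp ha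
    simpa using h1.mul_const R
  refine squeeze_zero (fun t => dist_nonneg) (fun t => ?_) ha'
  rw [Subtype.dist_eq, coe_conePt, dist_lineMap_left, Real.norm_of_nonneg (a t).2.1, dist_comm]
  exact mul_le_mul_of_nonneg_left (hR (faceMap f (x t)).2) (a t).2.1

/-- Coning over a point of a subface may use the composite morphism directly; this is what makes
omitting an intermediate object harmless. -/
theorem conePt_faceMap {α β γ : X.FaceCategory} (g : γ ⟶ β) (f : β ⟶ α) (x : X.P γ.cell)
    (a : unitInterval) : conePt f (faceMap g x) a = conePt (g ≫ f) x a := rfl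

theorem conePt_mem_relInt {α β : X.FaceCategory} (f : β ⟶ α) (x : X.P β.cell) {a : unitInterval}
    (ha : a < 1) : conePt f x a ∈ X.relInt α.cell :=
  (X.convex α.cell).lineMap_mem_intrinsicInterior (X.base_mem_relInt α) (faceMap f x).2 a.2.1 ha

theorem conePt_ne_base {α β : X.FaceCategory} {f : β ⟶ α} (hf : IsNonIdentity f) (x : X.P β.cell)
    {a : unitInterval} (ha : 0 < a) : conePt f x a ≠ X.base α := by
  intro h
  have h1 := congrArg Subtype.val h
  rw [coe_conePt, AffineMap.lineMap_eq_left_iff] at h1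
  rcases h1 with h1 | h1
  · refine (isNonIdentity_iff f).1 hf x ?_
    rw [← Subtype.ext h1]
    exact X.base_mem_relInt α
  · exact ha.ne' (Subtype.ext h1)

theorem conePt_congr {α β α' β' : X.FaceCategory} {f : β ⟶ α} {f' : β' ⟶ α'} {x : X.P β.cell}
    {x' : X.P β'.cell} {a a' : unitInterval}
    (hx : (⟨β, x⟩ : Σ β : X.FaceCategory, X.P β.cell) = ⟨β', x'⟩) (hα : α = α') (hf : HEq f f')
    (ha : a = a') :
    (⟨α, conePt f x a⟩ : Σ β : X.FaceCategory, X.P β.cell) = ⟨α', conePt f' x' a'⟩ := by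
  subst hα ha
  obtain ⟨rfl, hx⟩ := Sigma.mk.inj hx
  rw [eq_of_heq hx, eq_of_heq hf]

/-- Polar coordinates recover the boundary point and the ratio; the boundary point in turn
determines the face map and its relatively interior preimage. -/
theorem conePt_injective {α β α' β' : X.FaceCategory} {f : β ⟶ α} {f' : β' ⟶ α'} {x : X.P β.cell}
    {x' : X.P β'.cell} {a a' : unitInterval} (hf : IsNonIdentity f) (hf' : IsNonIdentity f')
    (hx : x ∈ X.relInt β.cell) (hx' : x' ∈ X.relInt β'.cell) (ha : 0 < a) (ha' : 0 < a')
    (h : (⟨α, conePt f x a⟩ : Σ β : X.FaceCategory, X.P β.cell) = ⟨α', conePt f' x' a'⟩) :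
    (⟨β, x⟩ : Σ β : X.FaceCategory, X.P β.cell) = ⟨β', x'⟩ ∧ α = α' ∧ HEq f f' ∧ a = a' := by
  obtain ⟨rfl, h⟩ := Sigma.mk.inj h
  have h1 := congrArg Subtype.val (eq_of_heq h)
  rw [coe_conePt, coe_conePt] at h1
  obtain ⟨h2, h3⟩ := (X.convex α.cell).lineMap_injective_of_notMem_intrinsicInterior
    (X.base_mem_relInt α) (faceMap f x).2 (faceMap f' x').2 ((isNonIdentity_iff f).1 hf x)
    ((isNonIdentity_iff f').1 hf' x') ha ha' h1
  obtain ⟨rfl, h4, h5⟩ := FaceCategory.ext_of_apply_eq hx hx' (Subtype.ext h3)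
  exact ⟨by rw [eq_of_heq h5], rfl, h4, Subtype.ext h2⟩

theorem exists_conePt_eq {α : X.FaceCategory} {y : X.P α.cell} (hy : y ≠ X.base α) :
    ∃ (β : X.FaceCategory) (f : β ⟶ α) (x : X.P β.cell) (a : unitInterval), IsNonIdentity f ∧
      conePt f x a = y := by
  obtain ⟨z, hz, hzi, a, ha0, ha1, hza⟩ := exists_lineMap_eq_of_mem (X.isPolytope α.cell).isCompact
    (X.base α).2 y.2 (fun h => hy (Subtype.ext h))
  obtain ⟨β, f, x, hf, hfx⟩ := exists_isNonIdentity_apply_eq (X := X) (y := ⟨z, hz⟩) hzi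
  exact ⟨β, f, x, ⟨a, ha0.le, ha1⟩, hf, Subtype.ext (by rw [coe_conePt, hfx]; exact hza)⟩

/-! ### The simplex of a chain in the polytope of its last object -/

/-- The proportion of the total weight of `t` that is not on the last vertex. -/
noncomputable def initRatio {d : ℕ} (t : Fin (d + 2) → ℝ) : unitInterval :=
  -- Clamping makes the ratio total. For nonnegative weights it changes nothing, and zero total
  -- weight gives ratio `0`.
  projIcc 0 1 zero_le_one ((∑ i : Fin (d + 1), t i.castSucc) / ∑ i, t i)

section initRatio

variable {d : ℕ} {t : Fin (d + 2) → ℝ}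

theorem coe_initRatio (ht : ∀ i, 0 ≤ t i) :
    (initRatio t : ℝ) = (∑ i : Fin (d + 1), t i.castSucc) / ∑ i, t i := by
  have h0 : 0 ≤ ∑ i : Fin (d + 1), t i.castSucc := Finset.sum_nonneg fun i _ => ht _
  have h1 : ∑ i : Fin (d + 1), t i.castSucc ≤ ∑ i, t i := by
    rw [Fin.sum_univ_castSucc t]
    exact le_add_of_nonneg_right (ht _)
  have : (∑ i : Fin (d + 1), t i.castSucc) / ∑ i, t i ∈ Icc (0 : ℝ) 1 :=
    ⟨div_nonneg h0 (h0.trans h1), div_le_one_of_le₀ h1 (h0.trans h1)⟩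
  rw [initRatio, projIcc_of_mem _ this]

theorem initRatio_eq_zero (h : ∑ i : Fin (d + 1), t i.castSucc = 0) : initRatio t = 0 := by
  rw [initRatio, h, zero_div]
  exact projIcc_left _

theorem initRatio_eq_one (h : t (Fin.last _) = 0) (ht : ∑ i, t i ≠ 0) : initRatio t = 1 := by
  have h1 := Fin.sum_univ_castSucc t
  rw [h, add_zero] at h1
  rw [initRatio, ← h1, div_self ht]
  exact projIcc_right _

theorem continuousAt_initRatio (ht : ∑ i, t i ≠ 0) :
    ContinuousAt (initRatio : (Fin (d + 2) → ℝ) → unitInterval) t := by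
  refine continuous_projIcc.continuousAt.comp (ContinuousAt.div ?_ ?_ ht)
  · exact (continuous_finsetSum (Finset.univ : Finset (Fin (d + 1)))
      fun i _ => continuous_apply (A := fun _ : Fin (d + 2) => ℝ) i.castSucc).continuousAt
  · exact (continuous_finsetSum (Finset.univ : Finset (Fin (d + 2)))
      fun i _ => continuous_apply (A := fun _ : Fin (d + 2) => ℝ) i).continuousAt

end initRatio

/-- The point with homogeneous barycentric coordinates `t` in the simplex that a chain spans in
the polytope of its last object. -/
noncomputable def eval : ∀ {d : ℕ} (F : ComposableArrows X.FaceCategory d) (_ : Fin (d + 1) → ℝ),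
    X.P (F.obj (Fin.last d)).cell
  | 0, _, _ => X.base _
  | _ + 1, F, t => conePt F.lastMap (eval F.δlast fun i => t i.castSucc) (initRatio t)

theorem eval_succ {d : ℕ} (F : ComposableArrows X.FaceCategory (d + 1)) (t : Fin (d + 2) → ℝ) :
    eval F t = conePt F.lastMap (eval F.δlast fun i => t i.castSucc) (initRatio t) := rfl

/-- The point of the initial chain may have no limit where all its weights vanish. There the ratio
tends to `0`, and the cone collapses uniformly to its apex. -/
theorem continuousAt_eval : ∀ {d : ℕ} (F : ComposableArrows X.FaceCategory d)
    {t : Fin (d + 1) → ℝ} (_ : ∑ i, t i ≠ 0), ContinuousAt (eval F) t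
  | 0, _, _, _ => continuousAt_const
  | d + 1, F, t, ht => by
    have hr := continuousAt_initRatio ht
    by_cases h : ∑ i : Fin (d + 1), t i.castSucc = 0
    · have h0 := initRatio_eq_zero h
      rw [ContinuousAt, h0] at hr
      rw [ContinuousAt, eval_succ, h0, conePt_zero]
      exact tendsto_conePt_zero F.lastMap _ hr
    · have h1 : ContinuousAt (fun t : Fin (d + 2) → ℝ => eval F.δlast fun i => t i.castSucc) t :=
        ContinuousAt.comp (f := fun (t : Fin (d + 2) → ℝ) (i : Fin (d + 1)) => t i.castSucc)
          (continuousAt_eval F.δlast h) (continuous_pi fun i => continuous_apply _).continuousAt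
      exact ContinuousAt.comp (f := fun t : Fin (d + 2) → ℝ =>
        (eval F.δlast fun i => t i.castSucc, initRatio t))
        (continuous_conePt F.lastMap).continuousAt (h1.prodMk hr)

/-- The point `eval F t`, as an element of the disjoint union of the polytopes. -/
noncomputable abbrev evalPt {d : ℕ} (F : ComposableArrows X.FaceCategory d) (t : Fin (d + 1) → ℝ) :
    Σ α : X.FaceCategory, X.P α.cell :=
  ⟨F.obj (Fin.last d), eval F t⟩

/-- A vertex of weight zero other than the last can be dropped without changing the point in the
polytope. Dropping the last one changes the polytope, and so is compatible only after mapping to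
`K`. -/
theorem evalPt_eraseObj_castSucc : ∀ {d : ℕ} (F : ComposableArrows X.FaceCategory (d + 1))
    (i : Fin (d + 1)) {t : Fin (d + 2) → ℝ} (_ : t i.castSucc = 0) (_ : ∑ i, t i ≠ 0),
    evalPt (F.eraseObj i.castSucc) (fun j => t (i.castSucc.succAbove j)) = evalPt F t
  | 0, F, i, t, hi, _ => by
    obtain rfl := Fin.fin_one_eq_zero i
    have h0 : initRatio t = 0 := initRatio_eq_zero (by simpa using hi)
    rw [evalPt, evalPt, eval_succ, h0, conePt_zero]
    rfl
  | d + 1, F, i, t, hi, ht => by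
    have hobj : (F.eraseObj i.castSucc).obj (Fin.last (d + 1)) = F.obj (Fin.last (d + 2)) := by
      change F.obj (i.castSucc.succAbove (Fin.last (d + 1))) = _
      rw [Fin.succAbove_castSucc_of_le _ _ (Fin.le_last i)]
      rfl
    have hsum : ∑ j, t (i.castSucc.succAbove j) = ∑ j, t j := by
      rw [Fin.sum_univ_succAbove t i.castSucc, hi, zero_add]
    have hinit : ∑ j : Fin (d + 1), t (i.castSucc.succAbove j.castSucc) =
        ∑ j : Fin (d + 2), t j.castSucc := by
      have h1 := Fin.sum_univ_castSucc fun j => t (i.castSucc.succAbove j)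
      have h2 := Fin.sum_univ_castSucc t
      have h3 : i.castSucc.succAbove (Fin.last (d + 1)) = Fin.last (d + 2) := by
        rw [Fin.succAbove_castSucc_of_le _ _ (Fin.le_last i)]
        rfl
      rw [h3] at h1
      linarith
    have hr : initRatio (fun j => t (i.castSucc.succAbove j)) = initRatio t := by
      rw [initRatio, initRatio, hsum, hinit]
    -- If all weight is on the last vertex, both sides are the apex, and the initial chains need not
    -- be compared.
    by_cases h : ∑ j : Fin (d + 2), t j.castSucc = 0
    · have h0 := initRatio_eq_zero h
      rw [evalPt, evalPt, eval_succ, eval_succ, hr, h0, conePt_zero, conePt_zero]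
      rw [hobj]
    have hlast : i.castSucc.succAbove (Fin.last d).succ = (Fin.last (d + 1)).succ := by
      rw [Fin.succ_last, Fin.succ_last, Fin.succAbove_castSucc_of_le _ _ (Fin.le_last i),
        Fin.succ_last]
    induction i using Fin.lastCases with
    | last =>
      -- The omitted object is the last one of the initial chain: the inner cone has ratio `1`, so
      -- its point lies on the face, and the two last morphisms compose.
      have h1 : initRatio (fun j : Fin (d + 2) => t j.castSucc) = 1 := initRatio_eq_one hi h
      have h2 : ∀ j : Fin (d + 1), (Fin.last (d + 1)).castSucc.succAbove j.castSucc =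
          j.castSucc.castSucc := fun j => by
        rw [Fin.castSucc_succAbove_castSucc, Fin.succAbove_last]
      rw [evalPt, evalPt, eval_succ, eval_succ, eval_succ, h1, conePt_one, conePt_faceMap]
      refine conePt_congr ?_ hobj ?_ hr
      · simp only [h2]
        change evalPt _ _ = evalPt _ _
        rw [δlast_eraseObj_castSucc, eraseObj_last]
      · have h3 : F.δlast.lastMap ≫ F.lastMap =
            F.map (homOfLE ((Fin.last d).castSucc.castSucc_lt_succ.le.trans
              (Fin.last (d + 1)).castSucc_le_succ)) := (F.map_comp _ _).symm
        rw [h3]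
        exact F.map_heq (h2 _) hlast _ _
    | cast i =>
      have ih := evalPt_eraseObj_castSucc F.δlast i (t := fun j => t j.castSucc) hi h
      rw [evalPt, evalPt, eval_succ, eval_succ]
      refine conePt_congr ?_ hobj ?_ hr
      · change evalPt _ _ = evalPt _ _
        rw [δlast_eraseObj_castSucc, ← ih]
        simp only [Fin.castSucc_succAbove_castSucc]
      · refine F.map_heq ?_ hlast _ _
        change i.castSucc.castSucc.succAbove (Fin.last d).castSucc = (Fin.last (d + 1)).castSucc
        rw [Fin.castSucc_succAbove_castSucc,
          Fin.succAbove_castSucc_of_le _ _ (Fin.le_last i)]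
        rfl

/-! ### Uniqueness of barycentric coordinates -/

/-- The last factor already maps into the relative boundary, so composites along the chain are never
identities and omitting an object leaves a valid chain. -/
theorem isNonIdentity_map {d : ℕ} {F : ComposableArrows X.FaceCategory d}
    (hF : ∀ i : Fin d, IsNonIdentity (F.map (homOfLE i.castSucc_le_succ))) {i j : Fin (d + 1)}
    (hij : i < j) : IsNonIdentity (F.map (homOfLE hij.le)) := by
  obtain ⟨k, rfl⟩ := Fin.exists_succ_eq.2 (Fin.ne_zero_of_lt hij)
  have h : F.map (homOfLE hij.le) = F.map (homOfLE (Fin.le_castSucc_iff.2 hij)) ≫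
      F.map (homOfLE k.castSucc_le_succ) := by
    rw [← F.map_comp]
    rfl
  rw [h]
  exact IsNonIdentity.comp_left _ (hF k)

theorem isNonIdentity_eraseObj {d : ℕ} {F : ComposableArrows X.FaceCategory (d + 1)}
    (hF : ∀ i : Fin (d + 1), IsNonIdentity (F.map (homOfLE i.castSucc_le_succ))) (i : Fin (d + 2))
    (j : Fin d) : IsNonIdentity ((F.eraseObj i).map (homOfLE j.castSucc_le_succ)) :=
  isNonIdentity_map hF (Fin.strictMono_succAbove i j.castSucc_lt_succ)

theorem initRatio_pos {d : ℕ} {t : Fin (d + 2) → ℝ} (ht : ∀ i, 0 < t i) : 0 < initRatio t := by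
  rw [← Subtype.coe_lt_coe, coe_initRatio fun i => (ht i).le]
  exact div_pos (Finset.sum_pos (fun i _ => ht _) Finset.univ_nonempty)
    (Finset.sum_pos (fun i _ => ht _) Finset.univ_nonempty)

theorem initRatio_lt_one {d : ℕ} {t : Fin (d + 2) → ℝ} (ht : ∀ i, 0 < t i) : initRatio t < 1 := by
  rw [← Subtype.coe_lt_coe, coe_initRatio fun i => (ht i).le]
  have h := Finset.sum_pos (fun i _ => ht i) Finset.univ_nonempty
  refine (div_lt_one h).2 ?_
  rw [Fin.sum_univ_castSucc t]
  exact lt_add_of_pos_right _ (ht _)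

theorem eval_mem_relInt {d : ℕ} (F : ComposableArrows X.FaceCategory d) {t : Fin (d + 1) → ℝ}
    (ht : ∀ i, 0 < t i) : eval F t ∈ X.relInt (F.obj (Fin.last d)).cell := by
  cases d with
  | zero => exact X.base_mem_relInt _
  | succ d => exact conePt_mem_relInt _ _ (initRatio_lt_one ht)

/-- Homogeneous coordinates scaled to have sum `1`. -/
noncomputable abbrev normalize {d : ℕ} (t : Fin (d + 1) → ℝ) : Fin (d + 1) → ℝ :=
  fun i => t i / ∑ j, t j

theorem normalize_castSucc {d : ℕ} {t : Fin (d + 2) → ℝ} (ht : ∀ i, 0 < t i) (i : Fin (d + 1)) :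
    normalize t i.castSucc = initRatio t * normalize (fun j => t j.castSucc) i := by
  have h1 : (0 : ℝ) < ∑ i : Fin (d + 1), t i.castSucc :=
    Finset.sum_pos (fun i _ => ht _) Finset.univ_nonempty
  rw [coe_initRatio fun i => (ht i).le]
  simp only [normalize]
  field_simp

theorem normalize_last {d : ℕ} {t : Fin (d + 2) → ℝ} (ht : ∀ i, 0 < t i) :
    normalize t (Fin.last _) = 1 - initRatio t := by
  have h := Finset.sum_pos (fun i _ => ht i) Finset.univ_nonempty
  rw [coe_initRatio fun i => (ht i).le, eq_sub_iff_add_eq, normalize, ← add_div,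
    div_eq_one_iff_eq h.ne', Fin.sum_univ_castSucc t, add_comm]

theorem normalize_zero {t : Fin 1 → ℝ} (ht : ∀ i, 0 < t i) : normalize t = fun _ => 1 := by
  funext i
  obtain rfl := Fin.fin_one_eq_zero i
  simp [normalize, (ht 0).ne']

/-- The apex is reached only by chains of length zero. Otherwise `conePt_injective` recovers the
last morphism, the ratio and the point of the initial chain, to which induction applies; the ratios
rebuild the normalized weights. -/
theorem evalPt_injective : ∀ {d d' : ℕ} {F : ComposableArrows X.FaceCategory d}
    {F' : ComposableArrows X.FaceCategory d'} {t : Fin (d + 1) → ℝ} {t' : Fin (d' + 1) → ℝ}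
    (_ : ∀ i : Fin d, IsNonIdentity (F.map (homOfLE i.castSucc_le_succ)))
    (_ : ∀ i : Fin d', IsNonIdentity (F'.map (homOfLE i.castSucc_le_succ)))
    (_ : ∀ i, 0 < t i) (_ : ∀ i, 0 < t' i) (_ : evalPt F t = evalPt F' t'),
    (⟨d, F, normalize t⟩ : Σ d, ComposableArrows X.FaceCategory d × (Fin (d + 1) → ℝ)) =
      ⟨d', F', normalize t'⟩
  | 0, 0, F, F', t, t', _, _, ht, ht', h => by
    rw [normalize_zero ht, normalize_zero ht',
      ComposableArrows.ext₀ (F := F) (G := F') (Sigma.mk.inj h).1]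
  | 0, d' + 1, F, F', t, t', _, hF', _, ht', h => by
    have key : ∀ {α α' β : X.FaceCategory} {f : β ⟶ α'} {x : X.P β.cell} {a : unitInterval},
        IsNonIdentity f → 0 < a → (⟨α, X.base α⟩ : Σ α : X.FaceCategory, X.P α.cell) ≠
          ⟨α', conePt f x a⟩ := by
      intro α α' β f x a hf ha h
      obtain ⟨rfl, h⟩ := Sigma.mk.inj h
      exact conePt_ne_base hf x ha (eq_of_heq h).symm
    exact (key (hF' (Fin.last _)) (initRatio_pos ht') h).elim
  | d + 1, 0, F, F', t, t', hF, hF', ht, ht', h =>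
    (evalPt_injective hF' hF ht' ht h.symm).symm
  | d + 1, d' + 1, F, F', t, t', hF, hF', ht, ht', h => by
    obtain ⟨h1, h2, h3, h4⟩ := conePt_injective (hF (Fin.last _)) (hF' (Fin.last _))
      (eval_mem_relInt F.δlast fun i => ht i.castSucc)
      (eval_mem_relInt F'.δlast fun i => ht' i.castSucc) (initRatio_pos ht) (initRatio_pos ht') h
    have ih := evalPt_injective (F := F.δlast) (F' := F'.δlast) (fun i => hF i.castSucc)
      (fun i => hF' i.castSucc) (fun i => ht i.castSucc) (fun i => ht' i.castSucc) h1
    obtain ⟨rfl, h5⟩ := Sigma.mk.inj ih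
    obtain ⟨h6, h7⟩ := Prod.mk.inj (eq_of_heq h5)
    obtain rfl := ext_of_δlast h6 h2 h3
    have h8 : normalize t = normalize t' := by
      funext i
      induction i using Fin.lastCases with
      | last => rw [normalize_last ht, normalize_last ht', h4]
      | cast i => rw [normalize_castSucc ht, normalize_castSucc ht', h4, h7]
    rw [h8]

end PolyhedralCWComplex

namespace PolyhedralCWComplex

open Set ComposableArrows

variable {K : Type u} [TopologicalSpace K] {X : PolyhedralCWComplex.{u, v} K}

/-! ### The simplices cover the polytopes -/

theorem eval_smul {a : ℝ} (ha : a ≠ 0) : ∀ {d : ℕ} (F : ComposableArrows X.FaceCategory d)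
    (t : Fin (d + 1) → ℝ), eval F (a • t) = eval F t
  | 0, _, _ => rfl
  | d + 1, F, t => by
    have h1 : initRatio (a • t) = initRatio t := by
      simp only [initRatio, Pi.smul_apply, smul_eq_mul, ← Finset.mul_sum]
      rw [mul_div_mul_left _ _ ha]
    rw [eval_succ, eval_succ, h1, ← eval_smul ha F.δlast fun i => t i.castSucc]
    rfl

/-- The cone over a simplex of the realization, along a non-identity morphism. -/
theorem exists_chain_conePt {α β : X.FaceCategory} {f : β ⟶ α} (hf : IsNonIdentity f)
    (γ : Σ d, NonIdentityChain X.FaceCategory d) : ∃ γ' : Σ d, NonIdentityChain X.FaceCategory d,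
      ∀ (t : stdSimplex ℝ (Fin (γ.1 + 1))) (x : X.P β.cell) (a : unitInterval),
        evalPt γ.2.1 t = ⟨β, x⟩ →
          ∃ t' : stdSimplex ℝ (Fin (γ'.1 + 1)), evalPt γ'.2.1 t' = ⟨α, conePt f x a⟩ := by
  obtain ⟨d, F, hF⟩ := γ
  by_cases hβ : F.obj (Fin.last d) = β
  swap
  -- A chain not ending at `β` contains no point of `P β`, so any chain serves.
  · exact ⟨⟨d, F, hF⟩, fun t x a h => (hβ (Sigma.mk.inj h).1).elim⟩
  subst hβ
  obtain ⟨G, rfl, rfl, hGf⟩ := F.exists_postcomp f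
  obtain rfl := eq_of_heq hGf
  refine ⟨⟨d + 1, G, fun i => ?_⟩, fun t x a h => ?_⟩
  · induction i using Fin.lastCases with
    | last => exact hf
    | cast i => exact hF i
  -- Weight `1 - a` goes to the new apex and the old weights are scaled by `a`, giving total `1` and
  -- ratio exactly `a`.
  let t' : Fin (d + 2) → ℝ := Fin.snoc (α := fun _ => ℝ) ((a : ℝ) • ⇑t) (1 - a)
  have ht'c : ∀ i : Fin (d + 1), t' i.castSucc = a * t i := fun i =>
    Fin.snoc_castSucc (α := fun _ => ℝ) _ _ _
  have ht'l : t' (Fin.last (d + 1)) = 1 - a := Fin.snoc_last (α := fun _ => ℝ) _ _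
  have hsumc : ∑ i : Fin (d + 1), t' i.castSucc = a := by
    simp only [ht'c, ← Finset.mul_sum]
    rw [stdSimplex.sum_eq_one, mul_one]
  have hsum : ∑ i, t' i = 1 := by
    rw [Fin.sum_univ_castSucc, hsumc, ht'l]
    ring
  have hnn : ∀ i, 0 ≤ t' i := by
    intro i
    induction i using Fin.lastCases with
    | last => rw [ht'l]; exact sub_nonneg.2 a.2.2
    | cast i => rw [ht'c]; exact mul_nonneg a.2.1 (t.2.1 i)
  have hr : initRatio t' = a := Subtype.ext (by rw [coe_initRatio hnn, hsumc, hsum, div_one])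
  refine ⟨⟨t', hnn, hsum⟩, ?_⟩
  change evalPt G t' = _
  rw [evalPt, eval_succ, hr]
  rcases eq_or_ne a 0 with rfl | ha
  · rw [conePt_zero, conePt_zero]
  · have hx : eval G.δlast (fun i => t' i.castSucc) = x := by
      have h1 : (fun i => t' (Fin.castSucc i)) = (a : ℝ) • ⇑t := funext ht'c
      rw [h1, eval_smul fun h => ha (Subtype.ext h)]
      exact eq_of_heq (Sigma.mk.inj h).2
    rw [hx]

/-- Finitely many simplices of the realization cover a given polytope. -/
theorem exists_finite_cover (α : X.FaceCategory) :
    ∃ S : Set (Σ d, NonIdentityChain X.FaceCategory d), S.Finite ∧ ∀ x : X.P α.cell,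
      ∃ γ ∈ S, ∃ t : stdSimplex ℝ (Fin (γ.1 + 1)), evalPt γ.2.1 t = ⟨α, x⟩ := by
  -- The number of faces replaces dimension as the induction measure, since sources of non-identity
  -- face maps have fewer faces.
  induction hn : {F | IsFace (X.P α.cell) F}.ncard using Nat.strong_induction_on generalizing α with
  | _ n ih =>
    subst hn
    let J := {p : Σ β : X.FaceCategory, β ⟶ α // IsNonIdentity p.2}
    have hS := fun p : J => ih _ (ncard_isFace_lt p.2) p.1.1 rfl
    choose S hSfin hS using hS
    have hg := fun p : J => exists_chain_conePt p.2
    choose g hg using hg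
    let γ₀ : Σ d, NonIdentityChain X.FaceCategory d := ⟨0, mk₀ α, fun i => i.elim0⟩
    refine ⟨insert γ₀ (⋃ p : J, g p '' S p),
      (Set.finite_iUnion fun p => (hSfin p).image _).insert _, fun x => ?_⟩
    by_cases hx : x = X.base α
    · exact ⟨γ₀, mem_insert _ _, stdSimplex.vertex (0 : Fin 1), by rw [hx]; rfl⟩
    · obtain ⟨β, f, y, a, hf, rfl⟩ := exists_conePt_eq hx
      obtain ⟨γ, hγ, t, ht⟩ := hS ⟨⟨β, f⟩, hf⟩ y
      obtain ⟨t', ht'⟩ := hg ⟨⟨β, f⟩, hf⟩ γ t y a ht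
      exact ⟨_, mem_insert_of_mem _ (mem_iUnion.2 ⟨⟨⟨β, f⟩, hf⟩, γ, hγ, rfl⟩), t', ht'⟩

/-! ### The homeomorphism -/

variable (X) in
/-- The map from the disjoint union of the simplices to `K`. -/
noncomputable def simplexMap (p : SimplexSum X.FaceCategory) : K :=
  X.map (p.1.2.1.obj (Fin.last p.1.1)).cell (eval p.1.2.1 p.2)

theorem map_eval_eq {d d' : ℕ} {F : ComposableArrows X.FaceCategory d}
    {F' : ComposableArrows X.FaceCategory d'} {t : Fin (d + 1) → ℝ} {t' : Fin (d' + 1) → ℝ}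
    (h : evalPt F t = evalPt F' t') :
    X.map (F.obj (Fin.last d)).cell (eval F t) = X.map (F'.obj (Fin.last d')).cell (eval F' t') :=
  congrArg (fun p : Σ α : X.FaceCategory, X.P α.cell => X.map p.1.cell p.2) h

/-- For the last vertex, ratio `1` places the point on the face given by the last morphism, and face
maps commute with the maps to `K`. The other vertices are already compatible in the polytope. -/
theorem simplexMap_eq_of_faceGluing {a b : SimplexSum X.FaceCategory}
    (h : FaceGluing X.FaceCategory a b) : X.simplexMap a = X.simplexMap b := by
  obtain ⟨d, ⟨F, hF⟩, ⟨F', hF'⟩, i, h, x⟩ := h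
  change F' = F.eraseObj i at h
  subst h
  have hsum : ∑ j, stdSimplex.map i.succAbove x j ≠ 0 := by
    rw [stdSimplex.sum_eq_one]
    exact one_ne_zero
  have h0 := stdSimplex.map_succAbove_apply_self i x
  have hx : ⇑x = fun j => stdSimplex.map i.succAbove x (i.succAbove j) :=
    funext fun j => (stdSimplex.map_succAbove_apply i x j).symm
  change X.map _ (eval (F.eraseObj i) ⇑x) = X.map _ (eval F ⇑(stdSimplex.map i.succAbove x))
  set t := ⇑(stdSimplex.map i.succAbove x)
  rw [hx]
  induction i using Fin.lastCases with
  | last =>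
    have h1 : initRatio t = 1 := initRatio_eq_one h0 hsum
    rw [eval_succ, h1, conePt_one, (isFaceMap_faceMap _).map_eq]
    apply map_eval_eq
    rw [eraseObj_last]
    simp only [Fin.succAbove_last]
  | cast i => exact map_eval_eq (evalPt_eraseObj_castSucc F i h0 hsum)

theorem continuous_simplexMap : Continuous X.simplexMap := by
  refine continuous_sigma fun γ => ?_
  suffices h : Continuous fun t : stdSimplex ℝ (Fin (γ.1 + 1)) => eval γ.2.1 ⇑t from
    (X.continuous_map (γ.2.1.obj (Fin.last γ.1)).cell).comp h
  rw [continuous_iff_continuousAt]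
  intro t
  have h : ∑ i, t i ≠ 0 := by
    rw [stdSimplex.sum_eq_one]
    exact one_ne_zero
  exact ContinuousAt.comp (f := fun t : stdSimplex ℝ (Fin (γ.1 + 1)) => ⇑t)
    (continuousAt_eval γ.2.1 h) continuous_subtype_val.continuousAt

/-- Every point of the realization has a representative with positive barycentric coordinates. -/
theorem exists_pos_representative : ∀ (d : ℕ) (γ : NonIdentityChain X.FaceCategory d)
    (t : stdSimplex ℝ (Fin (d + 1))), ∃ p : SimplexSum X.FaceCategory, (∀ i, 0 < p.2 i) ∧
      Quot.mk (FaceGluing X.FaceCategory) ⟨⟨d, γ⟩, t⟩ = Quot.mk (FaceGluing X.FaceCategory) p := by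
  intro d
  induction d with
  | zero =>
    refine fun γ t => ⟨⟨⟨0, γ⟩, t⟩, fun i => ?_, rfl⟩
    have h : ∑ j, t j = 1 := stdSimplex.sum_eq_one t
    rw [Fin.sum_univ_one] at h
    obtain rfl := Fin.fin_one_eq_zero i
    exact h.symm ▸ one_pos
  | succ d ih =>
    intro γ t
    by_cases ht : ∀ i, 0 < t i
    · exact ⟨⟨⟨d + 1, γ⟩, t⟩, ht, rfl⟩
    push Not at ht
    obtain ⟨i, hi⟩ := ht
    obtain ⟨s, rfl⟩ := stdSimplex.exists_map_succAbove_eq t (hi.antisymm (t.2.1 i))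
    obtain ⟨p, hp, hps⟩ := ih ⟨γ.1.eraseObj i, isNonIdentity_eraseObj γ.2 i⟩ s
    exact ⟨p, hp, (Quot.sound (FaceGluing.glue d γ _ i rfl s)).symm.trans hps⟩

theorem simplexMap_injective_of_pos {p q : SimplexSum X.FaceCategory} (hp : ∀ i, 0 < p.2 i)
    (hq : ∀ i, 0 < q.2 i) (h : X.simplexMap p = X.simplexMap q) : p = q := by
  obtain ⟨⟨d, F, hF⟩, t⟩ := p
  obtain ⟨⟨d', F', hF'⟩, t'⟩ := q
  have h1 : evalPt F t = evalPt F' t' :=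
    X.map_injective_on_relInt (eval_mem_relInt F hp) (eval_mem_relInt F' hq) h
  have h2 := evalPt_injective hF hF' hp hq h1
  obtain ⟨rfl, h3⟩ := Sigma.mk.inj h2
  obtain ⟨rfl, h4⟩ := Prod.mk.inj (eq_of_heq h3)
  have h5 : t = t' := by
    refine DFunLike.ext _ _ fun i => ?_
    have := congrFun h4 i
    simpa [normalize] using this
  rw [h5]

variable (X) in
/-- The map from the geometric realization of the face category to `K`. -/
noncomputable def realizationMap : GeometricRealization X.FaceCategory → K :=
  Quot.lift X.simplexMap fun _ _ => simplexMap_eq_of_faceGluing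

theorem continuous_realizationMap : Continuous X.realizationMap :=
  continuous_quot_lift _ continuous_simplexMap

theorem realizationMap_injective : Function.Injective X.realizationMap := by
  rintro ⟨⟨⟨d, γ⟩, t⟩⟩ ⟨⟨⟨d', γ'⟩, t'⟩⟩ h
  obtain ⟨p, hp, hpt⟩ := exists_pos_representative d γ t
  obtain ⟨q, hq, hqt⟩ := exists_pos_representative d' γ' t'
  change Quot.mk _ _ = Quot.mk _ _
  rw [hpt, hqt, simplexMap_injective_of_pos hp hq]
  have h1 := congrArg X.realizationMap hpt
  have h2 := congrArg X.realizationMap hqt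
  exact h1.symm.trans (h.trans h2)

theorem exists_simplexMap_eq {α : X.FaceCategory} {x : X.P α.cell}
    {γ : Σ d, NonIdentityChain X.FaceCategory d} {t : stdSimplex ℝ (Fin (γ.1 + 1))}
    (h : evalPt γ.2.1 t = ⟨α, x⟩) : X.simplexMap ⟨γ, t⟩ = X.map α.cell x :=
  congrArg (fun p : Σ α : X.FaceCategory, X.P α.cell => X.map p.1.cell p.2) h

theorem realizationMap_surjective : Function.Surjective X.realizationMap := by
  intro k
  obtain ⟨α, x, -, rfl⟩ := X.exists_mem_relInt_map_eq k
  obtain ⟨S, -, hS⟩ := exists_finite_cover (X := X) α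
  obtain ⟨γ, -, t, ht⟩ := hS x
  exact ⟨Quot.mk _ ⟨γ, t⟩, exists_simplexMap_eq ht⟩

/-- On one closed cell, the image of `B` is that of its traces on the finitely many simplices
covering the cell. These traces are compact, so their images are closed in the Hausdorff space `K`.
-/
theorem isClosedMap_realizationMap [T2Space K] : IsClosedMap X.realizationMap := by
  intro B hB
  rw [X.isClosed_iff]
  intro α
  obtain ⟨S, hSfin, hS⟩ := exists_finite_cover (X := X) α
  have hP : CompactSpace (X.P α) := isCompact_iff_compactSpace.1 (X.isPolytope α).isCompact
  let f : ∀ γ : Σ d, NonIdentityChain X.FaceCategory d,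
      stdSimplex ℝ (Fin (γ.1 + 1)) → GeometricRealization X.FaceCategory :=
    fun γ t => Quot.mk _ ⟨γ, t⟩
  have hf : ∀ γ, Continuous (f γ) := fun γ => continuous_quot_mk.comp continuous_sigmaMk
  have hcl : IsClosed (⋃ γ ∈ S, X.realizationMap '' (f γ '' (f γ ⁻¹' B))) := by
    refine hSfin.isClosed_biUnion fun γ _ => IsCompact.isClosed ?_
    exact (((hB.preimage (hf γ)).isCompact).image (hf γ)).image continuous_realizationMap
  have heq : X.realizationMap '' B ∩ range (X.map α) =
      (⋃ γ ∈ S, X.realizationMap '' (f γ '' (f γ ⁻¹' B))) ∩ range (X.map α) := by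
    ext k
    refine and_congr_left ?_
    rintro ⟨x, rfl⟩
    simp only [mem_iUnion]
    constructor
    · rintro ⟨b, hb, hbx⟩
      obtain ⟨γ, hγ, t, ht⟩ := hS x
      have h1 : X.realizationMap (f γ t) = X.map α x := exists_simplexMap_eq ht
      -- Injectivity identifies the given point of `B` with the one on a covering simplex, so no
      -- other simplices matter.
      obtain rfl := realizationMap_injective (h1.trans hbx.symm)
      exact ⟨γ, hγ, f γ t, ⟨t, hb, rfl⟩, h1⟩
    · rintro ⟨γ, hγ, _, ⟨t, ht, rfl⟩, h⟩
      exact ⟨_, ht, h⟩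
  rw [heq]
  exact hcl.inter (isCompact_range (X.continuous_map α)).isClosed

end PolyhedralCWComplex

/-- A polyhedral CW complex is homeomorphic to the geometric realization of its face category. -/
theorem mainTheorem6 {K : Type u} [TopologicalSpace K] [T2Space K]
    (X : PolyhedralCWComplex.{u, v} K) :
    Nonempty (GeometricRealization X.FaceCategory ≃ₜ K) :=
  ⟨(Equiv.ofBijective X.realizationMap ⟨PolyhedralCWComplex.realizationMap_injective,
    PolyhedralCWComplex.realizationMap_surjective⟩).toHomeomorphOfContinuousClosed
      PolyhedralCWComplex.continuous_realizationMap
      PolyhedralCWComplex.isClosedMap_realizationMap⟩
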